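/- Let $n\ge 0$, let $A^1,\dots,A^n,B^1,\dots,B^n,C$ be complex Hilbert spaces, and put $A=\bigotimes_{i}A^i$, $B=\bigotimes_i B^i$, $H=A\otimes B\otimes C$ (Hilbert space tensor products). Let $\mathcal A_0=\{0,\tfrac{\pi}{8},\tfrac{\pi}{4}\}$ and $\mathcal A=\mathcal A_0\cup\{a+\tfrac{\pi}{2}:a\in\mathcal A_0\}$. For every $i$ and every $a\in\mathcal A_0$ let $(P_{A^i}^{a},P_{A^i}^{a+\pi/2})$ and $(P_{B^i}^{a},P_{B^i}^{a+\pi/2})$ be orthogonal measurements on $A^i$ and $B^i$, i.e. pairs of orthogonal projectors with sum the identity. For $a,b\in\mathcal A^n$ put $P_A^a=\bigotimes_i P_{A^i}^{a^i}$ and $P_B^b=\bigotimes_i P_{B^i}^{b^i}$. Write $|\alpha\rangle=\cos\alpha\,|0\rangle+\sin\alpha\,|1\rangle\in\mathbb C^2$ for $\alpha\in\mathbb R$, $|a\rangle=\bigotimes_i|a^i\rangle$ for $a\in\mathcal A^n$, $|\phi^+\rangle=\tfrac1{\sqrt2}(|0\rangle|0\rangle+|1\rangle|1\rangle)$ and $|\Phi_n^+\rangle=2^{-n/2}\sum_{x\in\{0,1\}^n}|x\rangle\otimes|x\rangle$.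 Let $\Psi\in H$ be a state (a unit vector) that simulates $|\phi^+\rangle$ on each of the $n$ register pairs $(A^i,B^i)$: for every $i$ and all $\alpha,\beta\in\mathcal A$, $$\bigl\|(P_{A^i}^{\alpha}\otimes P_{B^i}^{\beta}\otimes \mathrm{Id})\Psi\bigr\|^2=\bigl|(\langle\alpha|\otimes\langle\beta|)|\phi^+\rangle\bigr|^2,$$ where $\mathrm{Id}$ is the identity on $C$ and on all the other registers. Put $$S=\mathrm{span}\{(P_A^a\otimes P_B^b\otimes\mathrm{Id}_C)\Psi:\ a,b\in\mathcal A^n\}.$$ Adjoin to each $A^i$ and $B^i$ a logical qubit, $\bar A^i=A_c^i\otimes A^i$, $\bar B^i=B_c^i\otimes B^i$ with $A^i_c=B^i_c=\mathbb C^2$, let $\bar A=\bigotimes_i\bar A^i$, $\bar B=\bigotimes_i\bar B^i$, $H_c=\bigotimes_iA_c^i\otimes\bigotimes_iB_c^i$, and identify $\bar H=H_c\otimes H$ with $\bar A\otimes\bar B\otimes C$. Let $\mathbb I:H\to\bar H$, $\mathbb I\psi=|0\cdots0\rangle\otimes\psi$, and $\mathbb P=\mathbb I^\dagger$. Then there are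 unitaries $U_{\bar A}\in\bigotimes_i\mathcal U(\bar A^i)$ and $U_{\bar B}\in\bigotimes_i\mathcal U(\bar B^i)$ (tensor products of unitaries of the single registers) such that, with $U=U_{\bar A}\otimes U_{\bar B}\otimes\mathrm{Id}_C$, the state $\Psi$ is $U$-equivalent to $|\Phi_n^+\rangle$ on $S$ with respect to $(P_A^a\otimes P_B^b\otimes\mathrm{Id}_C)_{a,b\in\mathcal A^n}$; that is, $\Psi\in S$, $$(P_A^a\otimes P_B^b\otimes\mathrm{Id}_C)\,s=\mathbb P\,U^\dagger\bigl(|a\rangle\langle a|\otimes|b\rangle\langle b|\otimes\mathrm{Id}_H\bigr)U\,\mathbb I\,s\qquad\text{for all }a,b\in\mathcal A^n,\ s\in S,$$ and $\mathbb I\Psi=U^\dagger(|\Phi_n^+\rangle\otimes\chi)$ for some $\chi\in H$. Moreover $\dim S=4^n$. -/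

import Mathlib

open scoped TensorProduct

universe u v w

noncomputable section

namespace SelfTest

/-! ### Hilbert spaces and their (completed) tensor products -/

/-- A complex Hilbert space of arbitrary dimension, as a bundled object. -/
structure Hilb : Type (u + 1) where
  carrier : Type u
  [normed : NormedAddCommGroup carrier]
  [inner : InnerProductSpace ℂ carrier]
  [complete : CompleteSpace carrier]

namespace Hilb

instance : CoeSort Hilb.{u} (Type u) := ⟨Hilb.carrier⟩

instance (H : Hilb.{u}) : NormedAddCommGroup H := H.normed

instance (H : Hilb.{u}) : InnerProductSpace ℂ H := H.inner

instance (H : Hilb.{u}) : CompleteSpace H := H.complete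

end Hilb

section Binary

variable (E : Type u) (F : Type v) [NormedAddCommGroup E] [InnerProductSpace ℂ E]
  [NormedAddCommGroup F] [InnerProductSpace ℂ F]

/-- The Hilbert space tensor product: the completion of the algebraic tensor product for the
inner product `⟪x ⊗ y, x' ⊗ y'⟫ = ⟪x, x'⟫ * ⟪y, y'⟫`. -/
abbrev HTensor : Type (max u v) := UniformSpace.Completion (E ⊗[ℂ] F)

variable {E F}

/-- The map `y ↦ x ⊗ y`. -/
def tensorLeft (x : E) : F →L[ℂ] HTensor E F :=
  UniformSpace.Completion.toComplL ∘L TensorProduct.mkL ℂ E F x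

/-- The tensor product `f ⊗ g` of two bounded operators. -/
def tensorMap {E' : Type*} {F' : Type*} [NormedAddCommGroup E'] [InnerProductSpace ℂ E']
    [NormedAddCommGroup F'] [InnerProductSpace ℂ F']
    (f : E →L[ℂ] E') (g : F →L[ℂ] F') : HTensor E F →L[ℂ] HTensor E' F' :=
  (TensorProduct.mapL f g).completion

end Binary

/-- The Hilbert space `⨂ i, A i`; the empty tensor product is the one-dimensional space. -/
def piTensor : (n : ℕ) → (Fin n → Hilb.{u}) → Hilb.{u}
  | 0, _ => ⟨EuclideanSpace ℂ PUnit.{u + 1}⟩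
  | n + 1, A => ⟨HTensor (A 0) (piTensor n fun i => A i.succ)⟩

/-- The operator `⨂ i, f i` on `⨂ i, A i`. -/
def piMap : (n : ℕ) → {A : Fin n → Hilb.{u}} → {A' : Fin n → Hilb.{u}} →
    (∀ i, A i →L[ℂ] A' i) → (piTensor n A →L[ℂ] piTensor n A')
  | 0, _, _, _ => ContinuousLinearMap.id ℂ (EuclideanSpace ℂ PUnit.{u + 1})
  | n + 1, _, _, f => tensorMap (f 0) (piMap n fun i => f i.succ)

/-- The operator on `⨂ i, A i` that acts as `f` on the factor `A i` and as the identity on all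
the other factors. -/
def onFactor {n : ℕ} {A : Fin n → Hilb.{u}} (i : Fin n) (f : A i →L[ℂ] A i) :
    piTensor n A →L[ℂ] piTensor n A :=
  piMap n (Function.update (fun j => ContinuousLinearMap.id ℂ (A j)) i f)

/-- `H = A ⊗ B ⊗ C`. -/
abbrev Triple (A : Type u) (B : Type v) (C : Type w)
    [NormedAddCommGroup A] [InnerProductSpace ℂ A]
    [NormedAddCommGroup B] [InnerProductSpace ℂ B]
    [NormedAddCommGroup C] [InnerProductSpace ℂ C] : Type (max u v w) :=
  HTensor A (HTensor B C)

/-- `f ⊗ g ⊗ Id_C`. -/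
def onAB {A A' : Type u} {B B' : Type v} (C : Type w)
    [NormedAddCommGroup A] [InnerProductSpace ℂ A]
    [NormedAddCommGroup A'] [InnerProductSpace ℂ A']
    [NormedAddCommGroup B] [InnerProductSpace ℂ B]
    [NormedAddCommGroup B'] [InnerProductSpace ℂ B']
    [NormedAddCommGroup C] [InnerProductSpace ℂ C]
    (f : A →L[ℂ] A') (g : B →L[ℂ] B') : Triple A B C →L[ℂ] Triple A' B' C :=
  tensorMap f (tensorMap g (ContinuousLinearMap.id ℂ C))

/-! ### Ideal states -/

/-- The qubit `ℂ²` with its computational basis. -/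
abbrev Qubit : Type := EuclideanSpace ℂ (Fin 2)

/-- The basis vector `|x⟩`. -/
def ket {X : Type*} [DecidableEq X] (x : X) : EuclideanSpace ℂ X := EuclideanSpace.single x 1

/-- `|α⟩ = cos α |0⟩ + sin α |1⟩`. -/
def ketAngle (α : ℝ) : Qubit := (Real.cos α : ℂ) • ket 0 + (Real.sin α : ℂ) • ket 1

/-- `φ ⊗ χ` in `ℂ^X ⊗ ℂ^Y = ℂ^(X × Y)`. -/
def ketProd {X Y : Type*} (φ : EuclideanSpace ℂ X) (χ : EuclideanSpace ℂ Y) :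
    EuclideanSpace ℂ (X × Y) :=
  WithLp.toLp 2 fun p => φ p.1 * χ p.2

/-- The state space `(ℂ²)^{⊗ n} = ℂ^({0,1}^n)` of `n` qubits. -/
abbrev Qubits (n : ℕ) : Type := EuclideanSpace ℂ (Fin n → Fin 2)

/-- `φ 0 ⊗ φ 1 ⊗ ⋯` in `(ℂ²)^{⊗ n}`. -/
def ketPi {n : ℕ} (φ : Fin n → Qubit) : Qubits n :=
  WithLp.toLp 2 fun x => ∏ i, φ i (x i)

/-- The EPR state `(|0⟩ ⊗ |0⟩ + |1⟩ ⊗ |1⟩) / √2`. -/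
def epr : EuclideanSpace ℂ (Fin 2 × Fin 2) :=
  (1 / (Real.sqrt 2 : ℂ)) • (ketProd (ket 0) (ket 0) + ketProd (ket 1) (ket 1))

/-- The logical space `H_c = A_c ⊗ B_c`, with `A_c` and `B_c` consisting of `n` qubits each. -/
abbrev Logical (n : ℕ) : Type := EuclideanSpace ℂ ((Fin n → Fin 2) × (Fin n → Fin 2))

/-- The state `|Φ_n^+⟩ = 2^{-n/2} ∑_{x ∈ {0,1}^n} |x⟩ ⊗ |x⟩` of `n` EPR pairs. -/
def eprN (n : ℕ) : Logical n :=
  (1 / (Real.sqrt (2 ^ n) : ℂ)) • ∑ x : Fin n → Fin 2, ketProd (ket x) (ket x)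

/-- The logical state `|a⟩ ⊗ |b⟩` for `a` and `b` vectors of `n` angles. -/
def ketAngles {n : ℕ} (a b : Fin n → ℝ) : Logical n :=
  ketProd (ketPi fun i => ketAngle (a i)) (ketPi fun i => ketAngle (b i))

/-! ### Measurements -/

/-- `𝒜₀ = {0, π/8, π/4}`. -/
def angles₀ : Set ℝ := {0, Real.pi / 8, Real.pi / 4}

/-- `𝒜 = 𝒜₀ ∪ 𝒜₁` with `𝒜₁ = {a + π/2 : a ∈ 𝒜₀}`. -/
def angles : Set ℝ := angles₀ ∪ (fun a => a + Real.pi / 2) '' angles₀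

/-- `(P a, P (a + π/2))` is an orthogonal measurement, that is, a pair of orthogonal projectors
that sum to the identity, for every `a ∈ 𝒜₀`. Only the values of `P` on `𝒜` matter. -/
def IsMeasurementFamily {E : Type*} [NormedAddCommGroup E] [InnerProductSpace ℂ E]
    [CompleteSpace E] (P : ℝ → E →L[ℂ] E) : Prop :=
  ∀ a ∈ angles₀, IsStarProjection (P a) ∧ IsStarProjection (P (a + Real.pi / 2)) ∧
    P a + P (a + Real.pi / 2) = ContinuousLinearMap.id ℂ E

/-! ### Simulation and equivalence -/

section Concepts

variable {W : Type*} {H : Type*} [NormedAddCommGroup H] [InnerProductSpace ℂ H]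

/-- `ψ` simulates `φ` with respect to the projectors `P w`, `w ∈ 𝒲`, where the label `w` is
identified with the ideal vector `|w⟩`: `‖P w ψ‖² = |⟨w|φ⟩|²` for all `w ∈ 𝒲`. -/
def Simulates {K : Type*} [NormedAddCommGroup K] [InnerProductSpace ℂ K] (𝒲 : Set W)
    (P : W → H →L[ℂ] H) (vec : W → K) (ψ : H) (φ : K) : Prop :=
  ∀ w ∈ 𝒲, ‖P w ψ‖ ^ 2 = ‖inner ℂ (vec w) φ‖ ^ 2

variable {Hc : Type*} [NormedAddCommGroup Hc] [InnerProductSpace ℂ Hc]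
  {Hbar : Type*} [NormedAddCommGroup Hbar] [InnerProductSpace ℂ Hbar]
  [CompleteSpace H] [CompleteSpace Hbar]

/-- For the bilinear map `τ φ χ = φ ⊗ χ` which identifies `Hbar` with `H_c ⊗ H`, the operator
`|φ⟩⟨φ| ⊗ Id_H`. It is written as the composition of `⟨φ| ⊗ Id_H`, the adjoint of `τ φ`, with
`|φ⟩ ⊗ Id_H = τ φ`. -/
def logicalProjector (τ : Hc →ₗ[ℂ] H →L[ℂ] Hbar) (φ : Hc) : Hbar →L[ℂ] Hbar :=
  τ φ ∘L ContinuousLinearMap.adjoint (τ φ)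

/-- The subspace `S` of `H` is `U`-equivalent to the logical space `H_c` with respect to the
projectors `P w`, `w ∈ 𝒲`: on `S` one has
`P w = ℙ U† (|w⟩⟨w| ⊗ Id_H) U 𝕀`, where `𝕀 = |0⟩ ⊗ Id_H` embeds `H` into `Hbar = H_c ⊗ H`
(by means of the fiducial logical state `zero`) and `ℙ = ⟨0| ⊗ Id_H = 𝕀†`. -/
def SubspaceEquivalent (τ : Hc →ₗ[ℂ] H →L[ℂ] Hbar) (zero : Hc) (𝒲 : Set W)
    (P : W → H →L[ℂ] H) (vec : W → Hc) (U : Hbar →L[ℂ] Hbar) (S : Submodule ℂ H) : Prop :=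
  U ∈ unitary (Hbar →L[ℂ] Hbar) ∧
  ∀ w ∈ 𝒲, ∀ s ∈ S, P w s =
    ContinuousLinearMap.adjoint (τ zero) (ContinuousLinearMap.adjoint U
      (logicalProjector τ (vec w) (U (τ zero s))))

/-- The state `ψ ∈ S` is `U`-equivalent to the logical state `φ` on `S`: the subspace `S` is
`U`-equivalent to `H_c` and `𝕀 ψ = U† (φ ⊗ χ)` for some `χ ∈ H`. -/
def StateEquivalent (τ : Hc →ₗ[ℂ] H →L[ℂ] Hbar) (zero : Hc) (𝒲 : Set W)
    (P : W → H →L[ℂ] H) (vec : W → Hc) (U : Hbar →L[ℂ] Hbar) (S : Submodule ℂ H)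
    (ψ : H) (φ : Hc) : Prop :=
  ψ ∈ S ∧ SubspaceEquivalent τ zero 𝒲 P vec U S ∧
  ∃ χ : H, τ zero ψ = ContinuousLinearMap.adjoint U (τ φ χ)

end Concepts

/-! ### Registers together with their logical qubits -/

/-- `Ā^i = A_c^i ⊗ A^i` with `A_c^i` a qubit. -/
def bar (E : Hilb.{u}) : Hilb.{u} := ⟨HTensor Qubit E⟩

/-- The map `χ ↦ φ ⊗ χ` from `E` to `Ē = E_c ⊗ E`. -/
def attach {E : Hilb.{u}} (φ : Qubit) : E →L[ℂ] bar E := tensorLeft φ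

/-- `⨂_i 𝒰(Ē^i)`: the operators `⨂ i, u i` on `⨂ i, Ē^i` with all `u i` unitary. -/
def tensorUnitaries {n : ℕ} (E : Fin n → Hilb.{u}) :
    Set (piTensor n (fun i => bar (E i)) →L[ℂ] piTensor n (fun i => bar (E i))) :=
  {V | ∃ u : ∀ i, bar (E i) →L[ℂ] bar (E i),
    (∀ i, u i ∈ unitary (bar (E i) →L[ℂ] bar (E i))) ∧ V = piMap n u}

section Registers

variable {n : ℕ} (A : Fin n → Hilb.{u}) (B : Fin n → Hilb.{v}) (C : Hilb.{w})

/-- `H = (⨂ i, A i) ⊗ (⨂ i, B i) ⊗ C`. -/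
abbrev Phys : Type (max u v w) := Triple (piTensor n A) (piTensor n B) C

/-- `H̄ = H_c ⊗ H`, with its factors grouped as `(⨂ i, Ā^i) ⊗ (⨂ i, B̄^i) ⊗ C`. -/
abbrev PhysBar : Type (max u v w) :=
  Triple (piTensor n fun i => bar (A i)) (piTensor n fun i => bar (B i)) C

/-- The canonical bilinear map `(φ, χ) ↦ φ ⊗ χ` from `H_c × H` to `H̄ = H_c ⊗ H`: for a basis
vector `|x⟩ ⊗ |y⟩` of `H_c = A_c ⊗ B_c` it sends `χ` to the vector of `H̄` that has `|x i⟩` in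
`A_c^i`, `|y i⟩` in `B_c^i` and `χ` in `H`. -/
def logicalTensor : Logical n →ₗ[ℂ] Phys A B C →L[ℂ] PhysBar A B C where
  toFun φ := ∑ x : Fin n → Fin 2, ∑ y : Fin n → Fin 2, φ (x, y) •
    onAB C (piMap n fun i => attach (E := A i) (ket (x i)))
      (piMap n fun i => attach (E := B i) (ket (y i)))
  map_add' φ φ' := by
    simp only [PiLp.add_apply, add_smul, Finset.sum_add_distrib]
  map_smul' c φ := by
    simp only [PiLp.smul_apply, smul_eq_mul, mul_smul, Finset.smul_sum, RingHom.id_apply]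

variable {A B} (PA : ∀ i, ℝ → A i →L[ℂ] A i) (PB : ∀ i, ℝ → B i →L[ℂ] B i)

/-- The projector that acts as `P_{A^i}^{a} ⊗ P_{B^i}^{b}` on the `i`-th pair of registers and as
the identity on all the other registers and on `C`; here `p = (a, b)`. -/
def pairProjector (i : Fin n) (p : ℝ × ℝ) : Phys A B C →L[ℂ] Phys A B C :=
  onAB C (onFactor i (PA i p.1)) (onFactor i (PB i p.2))

/-- `P_A^a ⊗ P_B^b ⊗ Id_C` with `P_A^a = ⨂ i, P_{A^i}^{a i}` and `P_B^b = ⨂ i, P_{B^i}^{b i}`;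
here `p = (a, b)`. -/
def fullProjector (p : (Fin n → ℝ) × (Fin n → ℝ)) : Phys A B C →L[ℂ] Phys A B C :=
  onAB C (piMap n fun i => PA i (p.1 i)) (piMap n fun i => PB i (p.2 i))

/-- `𝒜^n × 𝒜^n`. -/
def anglePairs (n : ℕ) : Set ((Fin n → ℝ) × (Fin n → ℝ)) :=
  {p | (∀ i, p.1 i ∈ angles) ∧ ∀ i, p.2 i ∈ angles}

/-- `S = span {(P_A^a ⊗ P_B^b ⊗ Id_C) Ψ : a, b ∈ 𝒜^n}`. -/
def measuredSpan (Ψ : Phys A B C) : Submodule ℂ (Phys A B C) :=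
  Submodule.span ℂ ((fun p => fullProjector C PA PB p Ψ) '' anglePairs n)

end Registers

end SelfTest

end

/-! For one pair, let `Z`, `D`, `X` be the reflections `2P - 1` at the angles 0, π/8, π/4. The
statistics say that equal angles give equal outcomes, so operators of the two sides agree on Ψ, and
that the three reflected vectors have the Gram matrix of plane unit vectors at angles 0, π/4, π/2.
Hence `D Ψ = (Z Ψ + X Ψ)/√2`. Since `D² = 1` and operators can be moved to the other side, this
forces `X Z Ψ = -Z X Ψ` (`MayersYao.anticomm`). On the span of Ψ, ZΨ, XΨ, ZXΨ the measurements
therefore act as the Pauli expressions `P a = (1 + cos 2a Z + sin 2a X)/2`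
(`SimulatesPair.apply_of_mem`).

The unitary of each register is a swap circuit: prepared in |0⟩, the logical qubit found in |0⟩ or
|1⟩ leaves `K₀ = p` or `K₁ = X(1 - p)` on the register, with `p = P 0`. Finding it in |a⟩ has the
effect `M†M`, `M = cos a K₀ + sin a K₁`, and by the Pauli relations this effect equals `P a` on the
span (`swapEffect_of_mem`). Applied on both sides to Ψ, equal outcomes give `p Ψ` and unequal ones
0, which is the EPR pair (`swapKraus_swapKraus`).

Operators of different pairs commute, so identities that hold on Ψ pair by pair multiply up to
identities of product operators on Ψ (`onAB_piMap_apply_eq`). This turns the results for one pair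
into those for n pairs, with no assumption on joint statistics.

For the dimension, every Kraus component of a measured vector is a multiple of the single vector
`zeroPart`, so the circuit embeds S in `H_c ⊗ zeroPart`, of dimension at most 4^n. Conversely,
measuring A in the computational and B in the Hadamard basis yields 4^n nonzero orthogonal vectors
in S. -/

namespace SelfTest

/-! ### Operators on the completed tensor product of two spaces -/

section Binary

variable {E F E' F' E'' F'' : Type*}
  [NormedAddCommGroup E] [InnerProductSpace ℂ E] [NormedAddCommGroup F] [InnerProductSpace ℂ F]
  [NormedAddCommGroup E'] [InnerProductSpace ℂ E'] [NormedAddCommGroup F'] [InnerProductSpace ℂ F']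
  [NormedAddCommGroup E''] [InnerProductSpace ℂ E'']
  [NormedAddCommGroup F''] [InnerProductSpace ℂ F'']

/-- Elementary tensors span a dense subspace. Functoriality and bilinearity of `tensorMap` are
checked on them. -/
theorem hTensor_hom_ext {G : Type*} [NormedAddCommGroup G] [InnerProductSpace ℂ G]
    {S T : HTensor E F →L[ℂ] G}
    (h : ∀ x y, S ((x ⊗ₜ[ℂ] y : E ⊗[ℂ] F) : HTensor E F) = T ((x ⊗ₜ[ℂ] y : E ⊗[ℂ] F))) :
    S = T := by
  have key : S ∘L UniformSpace.Completion.toComplL = T ∘L UniformSpace.Completion.toComplL := by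
    apply ContinuousLinearMap.coe_injective
    exact TensorProduct.ext' h
  ext z
  induction z using UniformSpace.Completion.induction_on with
  | hp => exact isClosed_eq S.continuous T.continuous
  | ih z => exact DFunLike.congr_fun key z

@[simp] theorem tensorMap_tmul (f : E →L[ℂ] E') (g : F →L[ℂ] F') (x : E) (y : F) :
    tensorMap f g ((x ⊗ₜ[ℂ] y : E ⊗[ℂ] F) : HTensor E F) =
      ((f x ⊗ₜ[ℂ] g y : E' ⊗[ℂ] F') : HTensor E' F') :=
  ContinuousLinearMap.completion_apply_coe _ _

theorem tensorLeft_apply (x : E) (y : F) :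
    tensorLeft x y = ((x ⊗ₜ[ℂ] y : E ⊗[ℂ] F) : HTensor E F) := rfl

theorem tensorMap_comp (f' : E' →L[ℂ] E'') (g' : F' →L[ℂ] F'') (f : E →L[ℂ] E')
    (g : F →L[ℂ] F') :
    tensorMap (f' ∘L f) (g' ∘L g) = tensorMap f' g' ∘L tensorMap f g :=
  hTensor_hom_ext fun x y => by simp

@[simp] theorem tensorMap_id :
    tensorMap (ContinuousLinearMap.id ℂ E) (ContinuousLinearMap.id ℂ F) =
      ContinuousLinearMap.id ℂ (HTensor E F) :=
  hTensor_hom_ext fun x y => by simp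

theorem tensorMap_add_left (f f' : E →L[ℂ] E') (g : F →L[ℂ] F') :
    tensorMap (f + f') g = tensorMap f g + tensorMap f' g :=
  hTensor_hom_ext fun x y => by
    simp [TensorProduct.add_tmul, UniformSpace.Completion.coe_add]

theorem tensorMap_add_right (f : E →L[ℂ] E') (g g' : F →L[ℂ] F') :
    tensorMap f (g + g') = tensorMap f g + tensorMap f g' :=
  hTensor_hom_ext fun x y => by
    simp [TensorProduct.tmul_add, UniformSpace.Completion.coe_add]

theorem tensorMap_smul_left (c : ℂ) (f : E →L[ℂ] E') (g : F →L[ℂ] F') :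
    tensorMap (c • f) g = c • tensorMap f g :=
  hTensor_hom_ext fun x y => by
    simp [← TensorProduct.smul_tmul', UniformSpace.Completion.coe_smul]

theorem tensorMap_smul_right (c : ℂ) (f : E →L[ℂ] E') (g : F →L[ℂ] F') :
    tensorMap f (c • g) = c • tensorMap f g :=
  hTensor_hom_ext fun x y => by
    simp [TensorProduct.tmul_smul, UniformSpace.Completion.coe_smul]

theorem tensorMap_comp_tensorLeft (f : E →L[ℂ] E') (g : F →L[ℂ] F') (x : E) :
    tensorMap f g ∘L tensorLeft x = tensorLeft (f x) ∘L g := by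
  ext y
  simp [tensorLeft_apply]

/-- This reads off the amplitude of a logical qubit from the state of qubit and register. -/
theorem adjoint_tensorLeft_comp_tensorLeft [CompleteSpace F] (x y : E) :
    ContinuousLinearMap.adjoint (tensorLeft (F := F) x) ∘L tensorLeft y =
      (inner ℂ x y : ℂ) • ContinuousLinearMap.id ℂ F := by
  ext z
  refine ext_inner_left ℂ fun t => ?_
  rw [ContinuousLinearMap.comp_apply, ContinuousLinearMap.adjoint_inner_right, tensorLeft_apply,
    tensorLeft_apply, UniformSpace.Completion.inner_coe, TensorProduct.inner_tmul]
  simp [inner_smul_right]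

variable [CompleteSpace E] [CompleteSpace F] [CompleteSpace E'] [CompleteSpace F']

theorem adjoint_tensorMap (f : E →L[ℂ] E') (g : F →L[ℂ] F') :
    ContinuousLinearMap.adjoint (tensorMap f g) =
      tensorMap (ContinuousLinearMap.adjoint f) (ContinuousLinearMap.adjoint g) := by
  symm
  rw [ContinuousLinearMap.eq_adjoint_iff]
  intro x y
  induction x, y using UniformSpace.Completion.induction_on₂ with
  | hp => exact isClosed_eq (by fun_prop) (by fun_prop)
  | ih x y =>
    induction x using TensorProduct.induction_on with
    | zero => rw [UniformSpace.Completion.coe_zero, map_zero, inner_zero_left, inner_zero_left]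
    | add x x' hx hx' =>
      rw [UniformSpace.Completion.coe_add, map_add, inner_add_left, inner_add_left, hx, hx']
    | tmul a b =>
      induction y using TensorProduct.induction_on with
      | zero => rw [UniformSpace.Completion.coe_zero, map_zero, inner_zero_right, inner_zero_right]
      | add y y' hy hy' =>
        rw [UniformSpace.Completion.coe_add, map_add, inner_add_right, inner_add_right, hy, hy']
      | tmul c d =>
        rw [tensorMap_tmul, tensorMap_tmul, UniformSpace.Completion.inner_coe,
          UniformSpace.Completion.inner_coe, TensorProduct.inner_tmul, TensorProduct.inner_tmul,
          ContinuousLinearMap.adjoint_inner_left, ContinuousLinearMap.adjoint_inner_left]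

end Binary

/-! ### Finite tensor products of operators -/

section Pi

variable {n : ℕ}

theorem piMap_comp {A A' A'' : Fin n → Hilb.{u}} (g : ∀ i, A' i →L[ℂ] A'' i)
    (f : ∀ i, A i →L[ℂ] A' i) :
    piMap n (fun i => g i ∘L f i) = piMap n g ∘L piMap n f := by
  induction n with
  | zero => rfl
  | succ n ih =>
    simp only [piMap]
    rw [ih]
    exact tensorMap_comp _ _ _ _

theorem piMap_id (A : Fin n → Hilb.{u}) :
    piMap n (fun i => ContinuousLinearMap.id ℂ (A i)) = ContinuousLinearMap.id ℂ _ := by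
  induction n with
  | zero => rfl
  | succ n ih =>
    simp only [piMap]
    rw [ih]
    exact tensorMap_id

theorem adjoint_piMap {A A' : Fin n → Hilb.{u}} (f : ∀ i, A i →L[ℂ] A' i) :
    ContinuousLinearMap.adjoint (piMap n f) =
      piMap n (fun i => ContinuousLinearMap.adjoint (f i)) := by
  induction n with
  | zero =>
    exact ContinuousLinearMap.adjoint_id (𝕜 := ℂ) (E := EuclideanSpace ℂ PUnit.{u + 1})
  | succ n ih =>
    simp only [piMap]
    rw [← ih]
    exact adjoint_tensorMap _ _

theorem piMap_update_add {A A' : Fin n → Hilb.{u}} (f : ∀ i, A i →L[ℂ] A' i) (i : Fin n)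
    (g g' : A i →L[ℂ] A' i) :
    piMap n (Function.update f i (g + g')) =
      piMap n (Function.update f i g) + piMap n (Function.update f i g') := by
  induction n with
  | zero => exact i.elim0
  | succ n ih =>
    simp only [piMap]
    cases i using Fin.cases with
    | zero =>
      simp only [Function.update_self, ne_eq, Fin.succ_ne_zero, not_false_eq_true,
        Function.update_of_ne]
      exact tensorMap_add_left _ _ _
    | succ i =>
      have h : ∀ k : A i.succ →L[ℂ] A' i.succ,
          (fun j : Fin n => Function.update f i.succ k j.succ) =
            Function.update (fun j : Fin n => f j.succ) i k := fun k => by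
        funext j
        by_cases hj : j = i
        · subst hj; simp
        · rw [Function.update_of_ne hj, Function.update_of_ne (by simpa using hj)]
      rw [h, h, h, ih]
      simp only [ne_eq, (Fin.succ_ne_zero i).symm, not_false_eq_true, Function.update_of_ne]
      exact tensorMap_add_right _ _ _

theorem piMap_update_smul {A A' : Fin n → Hilb.{u}} (f : ∀ i, A i →L[ℂ] A' i) (i : Fin n)
    (c : ℂ) (g : A i →L[ℂ] A' i) :
    piMap n (Function.update f i (c • g)) = c • piMap n (Function.update f i g) := by
  induction n with
  | zero => exact i.elim0
  | succ n ih =>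
    simp only [piMap]
    cases i using Fin.cases with
    | zero =>
      simp only [Function.update_self, ne_eq, Fin.succ_ne_zero, not_false_eq_true,
        Function.update_of_ne]
      exact tensorMap_smul_left _ _ _
    | succ i =>
      have h : ∀ k : A i.succ →L[ℂ] A' i.succ,
          (fun j : Fin n => Function.update f i.succ k j.succ) =
            Function.update (fun j : Fin n => f j.succ) i k := fun k => by
        funext j
        by_cases hj : j = i
        · subst hj; simp
        · rw [Function.update_of_ne hj, Function.update_of_ne (by simpa using hj)]
      rw [h, h, ih]
      simp only [ne_eq, (Fin.succ_ne_zero i).symm, not_false_eq_true, Function.update_of_ne]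
      exact tensorMap_smul_right _ _ _

/-- `f ↦ ⨂ i, f i` as a multilinear map. -/
noncomputable def piMapMultilinear (A A' : Fin n → Hilb.{u}) :
    MultilinearMap ℂ (fun i => A i →L[ℂ] A' i) (piTensor n A →L[ℂ] piTensor n A') where
  toFun := piMap n
  map_update_add' := by
    intro inst f i g g'
    -- The fields of `MultilinearMap` quantify over all decidability instances, whereas
    -- `piMap_update_add` uses the one of `Fin n`.
    obtain rfl := Subsingleton.elim inst (instDecidableEqFin n)
    exact piMap_update_add f i g g'
  map_update_smul' := by
    intro inst f i c g
    obtain rfl := Subsingleton.elim inst (instDecidableEqFin n)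
    exact piMap_update_smul f i c g

theorem piMap_sum {A A' : Fin n → Hilb.{u}} {X : Type*} [Fintype X]
    (f : ∀ i, X → (A i →L[ℂ] A' i)) :
    piMap n (fun i => ∑ x, f i x) = ∑ x : Fin n → X, piMap n (fun i => f i (x i)) :=
  (piMapMultilinear A A').map_sum f

theorem piMap_smul {A A' : Fin n → Hilb.{u}} (c : Fin n → ℂ) (f : ∀ i, A i →L[ℂ] A' i) :
    piMap n (fun i => c i • f i) = (∏ i, c i) • piMap n f :=
  (piMapMultilinear A A').map_smul_univ c f

theorem piMap_eq_zero {A A' : Fin n → Hilb.{u}} {f : ∀ i, A i →L[ℂ] A' i} (i : Fin n)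
    (h : f i = 0) : piMap n f = 0 :=
  (piMapMultilinear A A').map_coord_zero i h

theorem piMap_mem_unitary {A : Fin n → Hilb.{u}} {f : ∀ i, A i →L[ℂ] A i}
    (h : ∀ i, f i ∈ unitary (A i →L[ℂ] A i)) :
    piMap n f ∈ unitary (piTensor n A →L[ℂ] piTensor n A) := by
  rw [Unitary.mem_iff, ContinuousLinearMap.star_eq_adjoint, adjoint_piMap]
  have h1 := fun i => (Unitary.mem_iff.1 (h i)).1
  have h2 := fun i => (Unitary.mem_iff.1 (h i)).2
  simp only [ContinuousLinearMap.star_eq_adjoint, ContinuousLinearMap.mul_def] at h1 h2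
  simp only [ContinuousLinearMap.mul_def, ← piMap_comp, h1, h2]
  exact ⟨piMap_id A, piMap_id A⟩

end Pi

/-! ### Operators on `A ⊗ B ⊗ C` -/

section Triple

variable {A A' A'' : Type u} {B B' B'' : Type v} (C : Type w)
  [NormedAddCommGroup A] [InnerProductSpace ℂ A] [NormedAddCommGroup A'] [InnerProductSpace ℂ A']
  [NormedAddCommGroup A''] [InnerProductSpace ℂ A'']
  [NormedAddCommGroup B] [InnerProductSpace ℂ B] [NormedAddCommGroup B'] [InnerProductSpace ℂ B']
  [NormedAddCommGroup B''] [InnerProductSpace ℂ B'']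
  [NormedAddCommGroup C] [InnerProductSpace ℂ C]

theorem onAB_comp (f' : A' →L[ℂ] A'') (g' : B' →L[ℂ] B'') (f : A →L[ℂ] A') (g : B →L[ℂ] B') :
    onAB C (f' ∘L f) (g' ∘L g) = onAB C f' g' ∘L onAB C f g := by
  rw [onAB, onAB, onAB, ← tensorMap_comp, ← tensorMap_comp, ContinuousLinearMap.id_comp]

theorem onAB_id : onAB C (ContinuousLinearMap.id ℂ A) (ContinuousLinearMap.id ℂ B) =
    ContinuousLinearMap.id ℂ (Triple A B C) := by
  rw [onAB, tensorMap_id, tensorMap_id]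

/-- `(f, g) ↦ f ⊗ g ⊗ Id_C` as a bilinear map. -/
noncomputable def onABBilinear :
    (A →L[ℂ] A') →ₗ[ℂ] (B →L[ℂ] B') →ₗ[ℂ] (Triple A B C →L[ℂ] Triple A' B' C) :=
  LinearMap.mk₂ ℂ (onAB C) (fun _ _ _ => tensorMap_add_left _ _ _)
    (fun _ _ _ => tensorMap_smul_left _ _ _)
    (fun _ _ _ => by simp only [onAB, tensorMap_add_left, tensorMap_add_right])
    (fun _ _ _ => by simp only [onAB, tensorMap_smul_left, tensorMap_smul_right])

theorem onAB_zero_left (g : B →L[ℂ] B') : onAB C (0 : A →L[ℂ] A') g = 0 :=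
  (onABBilinear C).map_zero₂ g

theorem onAB_zero_right (f : A →L[ℂ] A') : onAB C f (0 : B →L[ℂ] B') = 0 :=
  (onABBilinear C f).map_zero

theorem onAB_add_left (f f' : A →L[ℂ] A') (g : B →L[ℂ] B') :
    onAB C (f + f') g = onAB C f g + onAB C f' g := (onABBilinear C).map_add₂ f f' g

theorem onAB_add_right (f : A →L[ℂ] A') (g g' : B →L[ℂ] B') :
    onAB C f (g + g') = onAB C f g + onAB C f g' := (onABBilinear C f).map_add g g'

theorem onAB_smul_left (c : ℂ) (f : A →L[ℂ] A') (g : B →L[ℂ] B') :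
    onAB C (c • f) g = c • onAB C f g := (onABBilinear C).map_smul₂ c f g

theorem onAB_smul_right (c : ℂ) (f : A →L[ℂ] A') (g : B →L[ℂ] B') :
    onAB C f (c • g) = c • onAB C f g := (onABBilinear C f).map_smul c g

theorem onAB_sum {X Y : Type*} [Fintype X] [Fintype Y] (f : X → (A →L[ℂ] A'))
    (g : Y → (B →L[ℂ] B')) :
    onAB C (∑ x, f x) (∑ y, g y) = ∑ x, ∑ y, onAB C (f x) (g y) :=
  LinearMap.map_sum₂ (onABBilinear C) _ _ _ |>.trans
    (Finset.sum_congr rfl fun x _ => map_sum (onABBilinear C (f x)) _ _)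

variable [CompleteSpace A] [CompleteSpace B] [CompleteSpace C] [CompleteSpace A']
  [CompleteSpace B']

theorem adjoint_onAB (f : A →L[ℂ] A') (g : B →L[ℂ] B') :
    ContinuousLinearMap.adjoint (onAB C f g) =
      onAB C (ContinuousLinearMap.adjoint f) (ContinuousLinearMap.adjoint g) := by
  rw [onAB, adjoint_tensorMap, adjoint_tensorMap, ContinuousLinearMap.adjoint_id, onAB]

theorem onAB_mem_unitary {f : A →L[ℂ] A} {g : B →L[ℂ] B} (hf : f ∈ unitary (A →L[ℂ] A))
    (hg : g ∈ unitary (B →L[ℂ] B)) :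
    onAB C f g ∈ unitary (Triple A B C →L[ℂ] Triple A B C) := by
  rw [Unitary.mem_iff, ContinuousLinearMap.star_eq_adjoint, adjoint_onAB]
  rw [Unitary.mem_iff, ContinuousLinearMap.star_eq_adjoint] at hf hg
  rw [ContinuousLinearMap.mul_def, ContinuousLinearMap.mul_def, ← onAB_comp, ← onAB_comp,
    ← ContinuousLinearMap.mul_def, ← ContinuousLinearMap.mul_def, ← ContinuousLinearMap.mul_def,
    ← ContinuousLinearMap.mul_def, hf.1, hf.2, hg.1, hg.2]
  exact ⟨onAB_id C, onAB_id C⟩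

end Triple

/-! ### The Mayers–Yao relations imply anticommutation -/

section SinglePair

variable {H : Type*} [NormedAddCommGroup H] [InnerProductSpace ℂ H]

/-- Two commuting triples of involutions whose actions on `Ψ` agree, the third one acting on `Ψ`
like the normalized sum of the first two. -/
structure MayersYao (Z X D Z' X' D' : H →L[ℂ] H) (Ψ : H) : Prop where
  ZZ : ∀ v, Z (Z v) = v
  XX : ∀ v, X (X v) = v
  DD : ∀ v, D (D v) = v
  ZZ' : ∀ v, Z' (Z' v) = v
  XX' : ∀ v, X' (X' v) = v
  DD' : ∀ v, D' (D' v) = v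
  comm : ∀ S ∈ ({Z, X, D} : Set (H →L[ℂ] H)), ∀ T ∈ ({Z', X', D'} : Set (H →L[ℂ] H)),
    ∀ v, T (S v) = S (T v)
  Z_eq : Z' Ψ = Z Ψ
  X_eq : X' Ψ = X Ψ
  D_eq : D' Ψ = D Ψ
  diag : D Ψ = ((√2 : ℝ) : ℂ)⁻¹ • (Z Ψ + X Ψ)

theorem inv_sqrt_two_mul_self : ((√2 : ℝ) : ℂ)⁻¹ * ((√2 : ℝ) : ℂ)⁻¹ = 2⁻¹ := by
  rw [← mul_inv, ← Complex.ofReal_mul, Real.mul_self_sqrt zero_le_two, Complex.ofReal_ofNat]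

namespace MayersYao

variable {Z X D Z' X' D' : H →L[ℂ] H} {Ψ : H}

theorem symm (h : MayersYao Z X D Z' X' D' Ψ) : MayersYao Z' X' D' Z X D Ψ where
  ZZ := h.ZZ'
  XX := h.XX'
  DD := h.DD'
  ZZ' := h.ZZ
  XX' := h.XX
  DD' := h.DD
  comm S hS T hT v := (h.comm T hT S hS v).symm
  Z_eq := h.Z_eq.symm
  X_eq := h.X_eq.symm
  D_eq := h.D_eq.symm
  diag := by rw [h.Z_eq, h.X_eq, h.D_eq, h.diag]

variable (h : MayersYao Z X D Z' X' D' Ψ)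

include h

theorem comm_Z_Z (v : H) : Z' (Z v) = Z (Z' v) := h.comm _ (by simp) _ (by simp) v
theorem comm_Z_X (v : H) : Z' (X v) = X (Z' v) := h.comm _ (by simp) _ (by simp) v
theorem comm_Z_D (v : H) : Z' (D v) = D (Z' v) := h.comm _ (by simp) _ (by simp) v
theorem comm_X_Z (v : H) : X' (Z v) = Z (X' v) := h.comm _ (by simp) _ (by simp) v
theorem comm_X_X (v : H) : X' (X v) = X (X' v) := h.comm _ (by simp) _ (by simp) v
theorem comm_X_D (v : H) : X' (D v) = D (X' v) := h.comm _ (by simp) _ (by simp) v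
theorem comm_D_Z (v : H) : D' (Z v) = Z (D' v) := h.comm _ (by simp) _ (by simp) v
theorem comm_D_X (v : H) : D' (X v) = X (D' v) := h.comm _ (by simp) _ (by simp) v
theorem comm_D_D (v : H) : D' (D v) = D (D' v) := h.comm _ (by simp) _ (by simp) v

/-- In `D² = 1` one factor is traded for `D'`, which moves past `Z` and `X` and is turned back into
`D` on Ψ. The result is `Ψ = (Z + X)²Ψ/2`; as `Z² = X² = 1`, the cross terms cancel. -/
theorem anticomm : X (Z Ψ) = -Z (X Ψ) := by
  have h1 : Ψ = (2 : ℂ)⁻¹ • (Z (Z Ψ + X Ψ) + X (Z Ψ + X Ψ)) := by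
    calc Ψ = D (D' Ψ) := by rw [h.D_eq, h.DD]
      _ = ((√2 : ℝ) : ℂ)⁻¹ • (Z (D Ψ) + X (D Ψ)) := by
        rw [← h.comm_D_D, h.diag, map_smul, map_add, h.comm_D_Z, h.comm_D_X, h.D_eq, h.diag]
      _ = _ := by
        rw [h.diag, map_smul, map_smul, ← smul_add, smul_smul, inv_sqrt_two_mul_self]
  rw [map_add, map_add, h.ZZ, h.XX] at h1
  have h2 : (2 : ℂ) • Ψ = Ψ + Z (X Ψ) + (X (Z Ψ) + Ψ) := by
    conv_lhs => rw [h1]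
    rw [smul_smul]
    norm_num
  rw [eq_neg_iff_add_eq_zero]
  have h3 : X (Z Ψ) + Z (X Ψ) = (Ψ + Z (X Ψ) + (X (Z Ψ) + Ψ)) - (2 : ℂ) • Ψ := by
    rw [two_smul]; abel
  rw [h3, ← h2, sub_self]

/-- The inner `X` becomes `X'` on Ψ and moves to the front, so that `anticomm` applies directly at
Ψ. -/
theorem X_Z_X : X (Z (X Ψ)) = -Z Ψ := by
  rw [← h.X_eq, ← h.comm_X_Z, ← h.comm_X_X, h.anticomm, map_neg, h.comm_X_Z, h.comm_X_X, h.X_eq,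
    h.XX]

end MayersYao

/-- The subspace that contains all vectors obtained from `Ψ` by measurements of one pair. -/
def wordSpan (Z X : H →L[ℂ] H) (Ψ : H) : Submodule ℂ H :=
  Submodule.span ℂ {Ψ, Z Ψ, X Ψ, Z (X Ψ)}

section WordSpan

variable {Z X : H →L[ℂ] H} {Ψ : H}

theorem wordSpan_le {N : Submodule ℂ H} (h1 : Ψ ∈ N) (h2 : Z Ψ ∈ N) (h3 : X Ψ ∈ N)
    (h4 : Z (X Ψ) ∈ N) : wordSpan Z X Ψ ≤ N :=
  Submodule.span_le.2 (by rintro v (rfl | rfl | rfl | rfl) <;> assumption)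

theorem self_mem_wordSpan : Ψ ∈ wordSpan Z X Ψ := Submodule.subset_span (by simp)
theorem Z_mem_wordSpan : Z Ψ ∈ wordSpan Z X Ψ := Submodule.subset_span (by simp)
theorem X_mem_wordSpan : X Ψ ∈ wordSpan Z X Ψ := Submodule.subset_span (by simp)
theorem Z_X_mem_wordSpan : Z (X Ψ) ∈ wordSpan Z X Ψ := Submodule.subset_span (by simp)

theorem map_mem_wordSpan {T : H →L[ℂ] H} (h1 : T Ψ ∈ wordSpan Z X Ψ)
    (h2 : T (Z Ψ) ∈ wordSpan Z X Ψ) (h3 : T (X Ψ) ∈ wordSpan Z X Ψ)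
    (h4 : T (Z (X Ψ)) ∈ wordSpan Z X Ψ) {v : H} (hv : v ∈ wordSpan Z X Ψ) :
    T v ∈ wordSpan Z X Ψ :=
  wordSpan_le (N := (wordSpan Z X Ψ).comap T.toLinearMap) h1 h2 h3 h4 hv

theorem eqOn_wordSpan {S T : H →L[ℂ] H} (h1 : S Ψ = T Ψ)
    (h2 : S (Z Ψ) = T (Z Ψ)) (h3 : S (X Ψ) = T (X Ψ))
    (h4 : S (Z (X Ψ)) = T (Z (X Ψ))) {v : H} (hv : v ∈ wordSpan Z X Ψ) : S v = T v :=
  wordSpan_le (N := LinearMap.eqLocus S.toLinearMap T.toLinearMap) h1 h2 h3 h4 hv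

end WordSpan

namespace MayersYao

variable {Z X D Z' X' D' : H →L[ℂ] H} {Ψ : H} (h : MayersYao Z X D Z' X' D' Ψ)

include h

/-- A word in the primed operators becomes on Ψ the reversed word in the unprimed ones. Hence
vectors prepared on one side can be measured on the other without leaving the span. -/
theorem wordSpan_symm : wordSpan Z' X' Ψ = wordSpan Z X Ψ := by
  -- Stated for all such systems, so that the reverse inclusion is the case `h.symm`.
  have key : ∀ {Z X D Z' X' D' : H →L[ℂ] H} {Ψ : H}, MayersYao Z X D Z' X' D' Ψ →
      wordSpan Z' X' Ψ ≤ wordSpan Z X Ψ := fun {Z X D Z' X' D' Ψ} h => by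
    refine wordSpan_le self_mem_wordSpan ?_ ?_ ?_
    · rw [h.Z_eq]; exact Z_mem_wordSpan
    · rw [h.X_eq]; exact X_mem_wordSpan
    · rw [h.X_eq, h.comm_Z_X, h.Z_eq, h.anticomm]
      exact neg_mem Z_X_mem_wordSpan
  exact le_antisymm (key h) (key h.symm)

theorem Z_mem {v : H} (hv : v ∈ wordSpan Z X Ψ) : Z v ∈ wordSpan Z X Ψ := by
  refine map_mem_wordSpan Z_mem_wordSpan ?_ Z_X_mem_wordSpan ?_ hv
  · rw [h.ZZ]; exact self_mem_wordSpan
  · rw [h.ZZ]; exact X_mem_wordSpan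

theorem X_mem {v : H} (hv : v ∈ wordSpan Z X Ψ) : X v ∈ wordSpan Z X Ψ := by
  refine map_mem_wordSpan X_mem_wordSpan ?_ ?_ ?_ hv
  · rw [h.anticomm]; exact neg_mem Z_X_mem_wordSpan
  · rw [h.XX]; exact self_mem_wordSpan
  · rw [h.X_Z_X]; exact neg_mem Z_mem_wordSpan

theorem X_Z_of_mem {v : H} (hv : v ∈ wordSpan Z X Ψ) : X (Z v) = -Z (X v) := by
  refine eqOn_wordSpan (S := X * Z) (T := -(Z * X)) h.anticomm ?_ ?_ ?_ hv
  · change X (Z (Z Ψ)) = -Z (X (Z Ψ))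
    rw [h.anticomm, map_neg, neg_neg, h.ZZ, h.ZZ]
  · change X (Z (X Ψ)) = -Z (X (X Ψ))
    rw [h.X_Z_X, h.XX]
  · change X (Z (Z (X Ψ))) = -Z (X (Z (X Ψ)))
    rw [h.X_Z_X, map_neg, neg_neg, h.ZZ, h.ZZ, h.XX]

/-- The other generators come from Ψ by applying `Z'` and `X'`, which commute with `D`, `Z` and `X`;
so the relation at Ψ propagates to them. -/
theorem D_of_mem {v : H} (hv : v ∈ wordSpan Z X Ψ) :
    D v = ((√2 : ℝ) : ℂ)⁻¹ • (Z v + X v) := by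
  have hZ : D (Z Ψ) = ((√2 : ℝ) : ℂ)⁻¹ • (Z (Z Ψ) + X (Z Ψ)) := by
    rw [← h.Z_eq, ← h.comm_Z_D, h.diag, map_smul, map_add, h.comm_Z_Z, h.comm_Z_X]
  have hX : D (X Ψ) = ((√2 : ℝ) : ℂ)⁻¹ • (Z (X Ψ) + X (X Ψ)) := by
    rw [← h.X_eq, ← h.comm_X_D, h.diag, map_smul, map_add, h.comm_X_Z, h.comm_X_X]
  refine eqOn_wordSpan (S := D) (T := ((√2 : ℝ) : ℂ)⁻¹ • (Z + X)) h.diag hZ hX ?_ hv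
  change D (Z (X Ψ)) = ((√2 : ℝ) : ℂ)⁻¹ • (Z (Z (X Ψ)) + X (Z (X Ψ)))
  rw [← h.X_eq, ← h.comm_X_Z, ← h.comm_X_D, hZ, map_smul, map_add, h.comm_X_Z, h.comm_X_X,
    h.comm_X_Z]

end MayersYao

end SinglePair

/-! ### From the statistics of one pair to the Mayers–Yao relations -/

section Measurements

variable {H : Type*} [NormedAddCommGroup H] [InnerProductSpace ℂ H]

/-- The reflection `2 p - 1` that belongs to the projector `p`. -/
noncomputable def reflOp (p : H →L[ℂ] H) : H →L[ℂ] H := (2 : ℂ) • p - 1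

theorem reflOp_apply (p : H →L[ℂ] H) (v : H) : reflOp p v = (2 : ℂ) • p v - v := rfl

theorem zero_mem_angles₀ : (0 : ℝ) ∈ angles₀ := by simp [angles₀]
theorem pi_div_eight_mem_angles₀ : Real.pi / 8 ∈ angles₀ := by simp [angles₀]
theorem pi_div_four_mem_angles₀ : Real.pi / 4 ∈ angles₀ := by simp [angles₀]

theorem mem_angles_of_mem {a : ℝ} (ha : a ∈ angles₀) : a ∈ angles := Or.inl ha

theorem add_mem_angles {a : ℝ} (ha : a ∈ angles₀) : a + Real.pi / 2 ∈ angles :=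
  Or.inr ⟨a, ha, rfl⟩

variable [CompleteSpace H]

theorem apply_apply_of_isStarProjection {p : H →L[ℂ] H} (hp : IsStarProjection p) (v : H) :
    p (p v) = p v := DFunLike.congr_fun hp.isIdempotentElem v

theorem inner_apply_of_isStarProjection {p : H →L[ℂ] H} (hp : IsStarProjection p) (v w : H) :
    inner ℂ (p v) w = inner ℂ v (p w) := by
  conv_lhs => rw [← hp.isSelfAdjoint.star_eq, ContinuousLinearMap.star_eq_adjoint]
  exact ContinuousLinearMap.adjoint_inner_left _ _ _

theorem reflOp_reflOp {p : H →L[ℂ] H} (hp : IsStarProjection p) (v : H) :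
    reflOp p (reflOp p v) = v := by
  rw [reflOp_apply, reflOp_apply, map_sub, map_smul, apply_apply_of_isStarProjection hp]
  module

theorem IsMeasurementFamily.add_pi_div_two_apply {P : ℝ → H →L[ℂ] H}
    (hP : IsMeasurementFamily P) {a : ℝ} (ha : a ∈ angles₀) (v : H) :
    P (a + Real.pi / 2) v = v - P a v :=
  eq_sub_of_add_eq' (DFunLike.congr_fun (hP a ha).2.2 v)

theorem IsMeasurementFamily.isStarProjection {P : ℝ → H →L[ℂ] H}
    (hP : IsMeasurementFamily P) {a : ℝ} (ha : a ∈ angles) : IsStarProjection (P a) := by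
  rcases ha with ha | ⟨a, ha, rfl⟩
  · exact (hP a ha).1
  · exact (hP a ha).2.1

/-- The commuting measurements `P` and `Q` show on `Ψ` the statistics of an EPR pair. -/
structure SimulatesPair (P Q : ℝ → H →L[ℂ] H) (Ψ : H) : Prop where
  left : IsMeasurementFamily P
  right : IsMeasurementFamily Q
  comm : ∀ a b v, Q b (P a v) = P a (Q b v)
  norm_eq_one : ‖Ψ‖ = 1
  sim : ∀ a ∈ angles, ∀ b ∈ angles, ‖P a (Q b Ψ)‖ ^ 2 = Real.cos (a - b) ^ 2 / 2

namespace SimulatesPair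

variable {P Q : ℝ → H →L[ℂ] H} {Ψ : H} (h : SimulatesPair P Q Ψ)

include h

theorem symm : SimulatesPair Q P Ψ where
  left := h.right
  right := h.left
  comm a b v := (h.comm b a v).symm
  norm_eq_one := h.norm_eq_one
  sim a ha b hb := by rw [h.comm, h.sim b hb a ha, ← Real.cos_neg, neg_sub]

/-- Outcomes `a` and `a + π/2` never occur together, as cos(π/2) = 0. So `P a Ψ = P a (Q a Ψ)`, and
by symmetry `Q a Ψ` is the same vector. -/
theorem apply_eq {a : ℝ} (ha : a ∈ angles₀) : Q a Ψ = P a Ψ := by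
  have key : ∀ {P Q : ℝ → H →L[ℂ] H}, SimulatesPair P Q Ψ → P a Ψ = P a (Q a Ψ) :=
    fun {P Q} h => by
    have h1 := h.sim a (mem_angles_of_mem ha) _ (add_mem_angles ha)
    rw [sub_add_cancel_left, Real.cos_neg, Real.cos_pi_div_two, zero_pow two_ne_zero, zero_div,
      sq_eq_zero_iff, norm_eq_zero, h.right.add_pi_div_two_apply ha, map_sub, sub_eq_zero] at h1
    exact h1
  exact (key h.symm).trans ((h.comm a a Ψ).trans (key h).symm)

theorem inner_apply {a b : ℝ} (ha : a ∈ angles₀) (hb : b ∈ angles₀) :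
    inner ℂ (P a Ψ) (P b Ψ) = ((Real.cos (a - b) ^ 2 / 2 : ℝ) : ℂ) := by
  rw [← h.sim a (mem_angles_of_mem ha) b (mem_angles_of_mem hb), Complex.ofReal_pow]
  refine Eq.trans ?_ (inner_self_eq_norm_sq_to_K (𝕜 := ℂ) (P a (Q b Ψ)))
  have hPa := (h.left a ha).1
  have hQb := (h.right b hb).1
  rw [inner_apply_of_isStarProjection hPa, inner_apply_of_isStarProjection hPa,
    apply_apply_of_isStarProjection hPa, inner_apply_of_isStarProjection hQb, h.comm,
    apply_apply_of_isStarProjection hQb, h.apply_eq hb]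

/-- The constant is `4 · cos²(a - b)/2 - 1 - 1 + 1`, since each outcome has probability 1/2. -/
theorem inner_reflOp {a b : ℝ} (ha : a ∈ angles₀) (hb : b ∈ angles₀) :
    inner ℂ (reflOp (P a) Ψ) (reflOp (P b) Ψ) = ((Real.cos (2 * (a - b)) : ℝ) : ℂ) := by
  have h1 : ∀ c ∈ angles₀, inner ℂ Ψ (P c Ψ) = (1 / 2 : ℂ) := fun c hc => by
    rw [← apply_apply_of_isStarProjection (h.left c hc).1,
      ← inner_apply_of_isStarProjection (h.left c hc).1, h.inner_apply hc hc]
    simp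
  have h2 : inner ℂ (P a Ψ) Ψ = (1 / 2 : ℂ) := by
    rw [inner_apply_of_isStarProjection (h.left a ha).1, h1 a ha]
  have h3 : inner ℂ Ψ Ψ = (1 : ℂ) := by
    rw [inner_self_eq_norm_sq_to_K, h.norm_eq_one]; simp
  simp only [reflOp_apply, inner_sub_left, inner_sub_right, inner_smul_left, inner_smul_right,
    h1 b hb, h2, h3, h.inner_apply ha hb, Real.cos_two_mul, map_ofNat]
  push_cast
  ring

/-- The Gram matrix determines all linear relations: the squared norm of the difference is computed
from it and vanishes, as for plane unit vectors at angles 0, π/4, π/2. -/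
theorem diag : reflOp (P (Real.pi / 8)) Ψ =
    ((√2 : ℝ) : ℂ)⁻¹ • (reflOp (P 0) Ψ + reflOp (P (Real.pi / 4)) Ψ) := by
  have hz := zero_mem_angles₀
  have hd := pi_div_eight_mem_angles₀
  have hx := pi_div_four_mem_angles₀
  rw [← sub_eq_zero, ← inner_self_eq_zero (𝕜 := ℂ)]
  simp only [inner_sub_left, inner_sub_right, inner_smul_left, inner_smul_right, inner_add_left,
    inner_add_right, h.inner_reflOp hz hz, h.inner_reflOp hz hd, h.inner_reflOp hz hx,
    h.inner_reflOp hd hz, h.inner_reflOp hd hd, h.inner_reflOp hd hx,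
    h.inner_reflOp hx hz, h.inner_reflOp hx hd, h.inner_reflOp hx hx, map_inv₀, Complex.conj_ofReal]
  have e1 : Real.cos (2 * (0 - Real.pi / 8)) = √2 / 2 := by
    rw [← Real.cos_pi_div_four, ← Real.cos_neg]; congr 1; ring
  have e2 : Real.cos (2 * (Real.pi / 8 - 0)) = √2 / 2 := by
    rw [← Real.cos_pi_div_four]; congr 1; ring
  have e3 : Real.cos (2 * (0 - Real.pi / 4)) = 0 := by
    rw [show 2 * (0 - Real.pi / 4) = -(Real.pi / 2) by ring, Real.cos_neg, Real.cos_pi_div_two]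
  have e4 : Real.cos (2 * (Real.pi / 4 - 0)) = 0 := by
    rw [show 2 * (Real.pi / 4 - 0) = Real.pi / 2 by ring, Real.cos_pi_div_two]
  have e5 : Real.cos (2 * (Real.pi / 8 - Real.pi / 4)) = √2 / 2 := by
    rw [← Real.cos_pi_div_four, ← Real.cos_neg]; congr 1; ring
  have e6 : Real.cos (2 * (Real.pi / 4 - Real.pi / 8)) = √2 / 2 := by
    rw [← Real.cos_pi_div_four]; congr 1; ring
  rw [e1, e2, e3, e4, e5, e6]
  simp only [sub_self, mul_zero, Real.cos_zero]
  have hs : ((√2 : ℝ) : ℂ) ≠ 0 := by simp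
  push_cast
  have hss := inv_sqrt_two_mul_self
  field_simp
  field_simp at hss
  rw [← hss]
  ring

theorem mayersYao : MayersYao (reflOp (P 0)) (reflOp (P (Real.pi / 4)))
    (reflOp (P (Real.pi / 8))) (reflOp (Q 0)) (reflOp (Q (Real.pi / 4)))
    (reflOp (Q (Real.pi / 8))) Ψ where
  ZZ := reflOp_reflOp (h.left _ zero_mem_angles₀).1
  XX := reflOp_reflOp (h.left _ pi_div_four_mem_angles₀).1
  DD := reflOp_reflOp (h.left _ pi_div_eight_mem_angles₀).1
  ZZ' := reflOp_reflOp (h.right _ zero_mem_angles₀).1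
  XX' := reflOp_reflOp (h.right _ pi_div_four_mem_angles₀).1
  DD' := reflOp_reflOp (h.right _ pi_div_eight_mem_angles₀).1
  comm := by
    have key : ∀ a b v, reflOp (Q b) (reflOp (P a) v) = reflOp (P a) (reflOp (Q b) v) :=
      fun a b v => by
      simp only [reflOp_apply, map_sub, map_smul, h.comm]
      module
    rintro S (rfl | rfl | rfl) T (rfl | rfl | rfl) v <;> exact key _ _ v
  Z_eq := by rw [reflOp_apply, reflOp_apply, h.apply_eq zero_mem_angles₀]
  X_eq := by rw [reflOp_apply, reflOp_apply, h.apply_eq pi_div_four_mem_angles₀]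
  D_eq := by rw [reflOp_apply, reflOp_apply, h.apply_eq pi_div_eight_mem_angles₀]
  diag := h.diag

end SimulatesPair

/-- The subspace that contains all vectors obtained from `Ψ` by measurements of one pair. -/
noncomputable abbrev pairSpan (P : ℝ → H →L[ℂ] H) (Ψ : H) : Submodule ℂ H :=
  wordSpan (reflOp (P 0)) (reflOp (P (Real.pi / 4))) Ψ

namespace SimulatesPair

variable {P Q : ℝ → H →L[ℂ] H} {Ψ : H} (h : SimulatesPair P Q Ψ)

include h

/-- At 0 and π/4 this is the definition of the reflections, and at π/8 it is `D_of_mem`. Passing to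
the complementary projector reverses both signs, as does adding π to 2a. -/
theorem apply_of_mem {a : ℝ} (ha : a ∈ angles) {v : H} (hv : v ∈ pairSpan P Ψ) :
    P a v = (2 : ℂ)⁻¹ • (v + ((Real.cos (2 * a) : ℝ) : ℂ) • reflOp (P 0) v +
      ((Real.sin (2 * a) : ℝ) : ℂ) • reflOp (P (Real.pi / 4)) v) := by
  have key : ∀ a ∈ angles₀, P a v =
      (2 : ℂ)⁻¹ • (v + ((Real.cos (2 * a) : ℝ) : ℂ) • reflOp (P 0) v +
      ((Real.sin (2 * a) : ℝ) : ℂ) • reflOp (P (Real.pi / 4)) v) := by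
    rintro a (rfl | rfl | rfl)
    · rw [mul_zero, Real.cos_zero, Real.sin_zero, reflOp_apply]
      push_cast
      module
    · have e : 2 * (Real.pi / 8) = Real.pi / 4 := by ring
      have hD := h.mayersYao.D_of_mem hv
      have hq : P (Real.pi / 8) v = (2 : ℂ)⁻¹ • (v + reflOp (P (Real.pi / 8)) v) := by
        rw [reflOp_apply]; module
      have hc : ((√2 : ℝ) : ℂ)⁻¹ = ((√2 / 2 : ℝ) : ℂ) := by
        rw [← Complex.ofReal_inv]
        congr 1
        rw [Real.sqrt_div_self', one_div]
      rw [hq, hD, e, Real.cos_pi_div_four, Real.sin_pi_div_four, hc]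
      module
    · have e : 2 * (Real.pi / 4) = Real.pi / 2 := by ring
      rw [e, Real.cos_pi_div_two, Real.sin_pi_div_two, reflOp_apply, reflOp_apply]
      push_cast
      module
  rcases ha with ha | ⟨a, ha, rfl⟩
  · exact key a ha
  · change P (a + Real.pi / 2) v =
      (2 : ℂ)⁻¹ • (v + ((Real.cos (2 * (a + Real.pi / 2)) : ℝ) : ℂ) • reflOp (P 0) v +
        ((Real.sin (2 * (a + Real.pi / 2)) : ℝ) : ℂ) • reflOp (P (Real.pi / 4)) v)
    have e : 2 * (a + Real.pi / 2) = 2 * a + Real.pi := by ring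
    rw [h.left.add_pi_div_two_apply ha, key a ha, e, Real.cos_add_pi, Real.sin_add_pi]
    push_cast
    module

theorem apply_mem {a : ℝ} (ha : a ∈ angles) {v : H} (hv : v ∈ pairSpan P Ψ) :
    P a v ∈ pairSpan P Ψ := by
  rw [h.apply_of_mem ha hv]
  exact Submodule.smul_mem _ _ (add_mem (add_mem hv (Submodule.smul_mem _ _
    (h.mayersYao.Z_mem hv))) (Submodule.smul_mem _ _ (h.mayersYao.X_mem hv)))

theorem pairSpan_symm : pairSpan Q Ψ = pairSpan P Ψ := h.mayersYao.wordSpan_symm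

end SimulatesPair

end Measurements

/-! ### The swap circuit on one pair -/

section Swap

variable {H : Type*} [NormedAddCommGroup H] [InnerProductSpace ℂ H]

/-- The operators that the swap circuit built from the projectors `p` and `r` of the computational
and the Hadamard basis applies to the register when the logical qubit is found in `|k⟩`. -/
noncomputable def swapKraus (p r : H →L[ℂ] H) : Fin 2 → (H →L[ℂ] H) := ![p, reflOp r * (1 - p)]

/-- The operator that the swap circuit applies to the register when the logical qubit is found in
`|a⟩`. -/
noncomputable def swapAmplitude (p r : H →L[ℂ] H) (a : ℝ) : H →L[ℂ] H :=
  ∑ k, ketAngle a k • swapKraus p r k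

theorem apply_eq_reflOp (p : H →L[ℂ] H) (v : H) : p v = (2 : ℂ)⁻¹ • (v + reflOp p v) := by
  rw [reflOp_apply]; module

theorem ketAngle_zero (a : ℝ) : ketAngle a 0 = ((Real.cos a : ℝ) : ℂ) := by
  simp [ketAngle, ket]

theorem ketAngle_one (a : ℝ) : ketAngle a 1 = ((Real.sin a : ℝ) : ℂ) := by
  simp [ketAngle, ket]

theorem swapKraus_one_apply (p r : H →L[ℂ] H) (v : H) :
    swapKraus p r 1 v = reflOp r (v - p v) := rfl

theorem swapAmplitude_eq (p r : H →L[ℂ] H) (a : ℝ) : swapAmplitude p r a =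
    ((Real.cos a : ℝ) : ℂ) • p + ((Real.sin a : ℝ) : ℂ) • (reflOp r * (1 - p)) := by
  rw [swapAmplitude, Fin.sum_univ_two, ketAngle_zero, ketAngle_one]
  rfl

variable [CompleteSpace H]

/-- The effect that corresponds to finding the logical qubit in `|a⟩` after the swap circuit. -/
noncomputable def swapEffect (p r : H →L[ℂ] H) (a : ℝ) : H →L[ℂ] H :=
  star (swapAmplitude p r a) * swapAmplitude p r a

theorem isSelfAdjoint_reflOp {r : H →L[ℂ] H} (hr : IsStarProjection r) :
    IsSelfAdjoint (reflOp r) := by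
  refine IsSelfAdjoint.sub (IsSelfAdjoint.smul ?_ hr.isSelfAdjoint) (.one _)
  rw [IsSelfAdjoint, Complex.star_def, map_ofNat]

theorem swapEffect_eq {p r : H →L[ℂ] H} (hp : IsStarProjection p) (hr : IsStarProjection r)
    (a : ℝ) : swapEffect p r a =
      (((Real.cos a : ℝ) : ℂ) • p + ((Real.sin a : ℝ) : ℂ) • ((1 - p) * reflOp r)) *
      (((Real.cos a : ℝ) : ℂ) • p + ((Real.sin a : ℝ) : ℂ) • (reflOp r * (1 - p))) := by
  rw [swapEffect, swapAmplitude_eq, star_add, star_smul, star_smul, star_mul, star_sub, star_one,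
    hp.isSelfAdjoint.star_eq, (isSelfAdjoint_reflOp hr).star_eq, Complex.star_def,
    Complex.conj_ofReal, Complex.conj_ofReal]

section Hom

variable {K : Type*} [NormedAddCommGroup K] [InnerProductSpace ℂ K] [CompleteSpace K]
  (φ : (H →L[ℂ] H) →⋆ₐ[ℂ] (K →L[ℂ] K))

theorem map_reflOp (r : H →L[ℂ] H) : φ (reflOp r) = reflOp (φ r) := by
  simp [reflOp]

theorem map_swapKraus (p r : H →L[ℂ] H) (k : Fin 2) :
    φ (swapKraus p r k) = swapKraus (φ p) (φ r) k := by
  fin_cases k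
  · rfl
  · simp [swapKraus, map_reflOp]

theorem map_swapEffect (p r : H →L[ℂ] H) (a : ℝ) :
    φ (swapEffect p r a) = swapEffect (φ p) (φ r) a := by
  have h : φ (swapAmplitude p r a) = swapAmplitude (φ p) (φ r) a := by
    simp [swapAmplitude, map_swapKraus]
  rw [swapEffect, map_mul, map_star, h, swapEffect]

end Hom

/-- The angle of the basis vector `|k⟩`. -/
noncomputable def angleZ : Fin 2 → ℝ := ![0, 0 + Real.pi / 2]

/-- The angle of the `k`-th vector of the Hadamard basis. -/
noncomputable def angleX : Fin 2 → ℝ := ![Real.pi / 4, Real.pi / 4 + Real.pi / 2]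

theorem angleZ_mem (k : Fin 2) : angleZ k ∈ angles := by
  fin_cases k
  · exact mem_angles_of_mem zero_mem_angles₀
  · exact add_mem_angles zero_mem_angles₀

theorem angleX_mem (k : Fin 2) : angleX k ∈ angles := by
  fin_cases k
  · exact mem_angles_of_mem pi_div_four_mem_angles₀
  · exact add_mem_angles pi_div_four_mem_angles₀

namespace SimulatesPair

variable {P Q : ℝ → H →L[ℂ] H} {Ψ : H} (h : SimulatesPair P Q Ψ)

include h

theorem isStarProjection_zero : IsStarProjection (P 0) := (h.left _ zero_mem_angles₀).1

/-- With c = cos a, s = sin a and `p = P 0`, anticommutation gives `pX = X(1 - p)` on the span. The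
cross terms of the effect then add up to `cs X`, and the effect is `c² p + s² (1 - p) + cs X`, the
Pauli form of `P a`. -/
theorem swapEffect_of_mem {a : ℝ} (ha : a ∈ angles) {v : H} (hv : v ∈ pairSpan P Ψ) :
    swapEffect (P 0) (P (Real.pi / 4)) a v = P a v := by
  have hM := h.mayersYao
  rw [h.apply_of_mem ha hv, swapEffect_eq (h.left _ zero_mem_angles₀).1
    (h.left _ pi_div_four_mem_angles₀).1]
  set c : ℂ := ((Real.cos a : ℝ) : ℂ) with hc
  set s : ℂ := ((Real.sin a : ℝ) : ℂ) with hs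
  have hcs : c ^ 2 + s ^ 2 = 1 := by
    rw [hc, hs, ← Complex.ofReal_pow, ← Complex.ofReal_pow, ← Complex.ofReal_add,
      Real.cos_sq_add_sin_sq, Complex.ofReal_one]
  have h2c : ((Real.cos (2 * a) : ℝ) : ℂ) = c ^ 2 - s ^ 2 := by
    rw [hc, hs, ← Complex.ofReal_pow, ← Complex.ofReal_pow, ← Complex.ofReal_sub, Real.cos_two_mul']
  have h2s : ((Real.sin (2 * a) : ℝ) : ℂ) = 2 * s * c := by
    rw [hc, hs, Real.sin_two_mul]; push_cast; rfl
  rw [h2c, h2s]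
  set Z := reflOp (P 0) with hZ
  set X := reflOp (P (Real.pi / 4)) with hX
  have hp : ∀ v, P 0 v = (2 : ℂ)⁻¹ • (v + Z v) := apply_eq_reflOp _
  simp only [mul_apply_eq_comp, _root_.add_apply,
    _root_.smul_apply, _root_.sub_apply, one_apply_eq_self,
    hp, map_add, map_sub, map_smul, hM.ZZ, hM.XX, hM.X_Z_of_mem hv,
    hM.X_Z_of_mem (hM.X_mem hv), map_neg]
  match_scalars
  all_goals first
    | ring1
    | linear_combination (1 / 2 : ℂ) * hcs

theorem swapKraus_mem {v : H} (hv : v ∈ pairSpan P Ψ) (k : Fin 2) :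
    swapKraus (P 0) (P (Real.pi / 4)) k v ∈ pairSpan P Ψ := by
  have hp := h.apply_mem (mem_angles_of_mem zero_mem_angles₀) hv
  fin_cases k
  · exact hp
  · exact h.mayersYao.X_mem (sub_mem hv hp)

/-- On the span `X(1 - p) = pX`: whatever the outcome, the circuit leaves the register in the range
of `p`. -/
theorem zero_swapKraus {v : H} (hv : v ∈ pairSpan P Ψ) (k : Fin 2) :
    P 0 (swapKraus (P 0) (P (Real.pi / 4)) k v) = swapKraus (P 0) (P (Real.pi / 4)) k v := by
  have hM := h.mayersYao
  fin_cases k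
  · exact apply_apply_of_isStarProjection h.isStarProjection_zero v
  · change P 0 (swapKraus (P 0) (P (Real.pi / 4)) 1 v) = swapKraus (P 0) (P (Real.pi / 4)) 1 v
    simp only [swapKraus_one_apply, apply_eq_reflOp (P 0), map_add, map_sub, map_smul,
      hM.ZZ, hM.X_Z_of_mem hv, map_neg]
    module

theorem swapKraus_comm (a : ℝ) (k : Fin 2) (v : H) :
    Q a (swapKraus (P 0) (P (Real.pi / 4)) k v) = swapKraus (P 0) (P (Real.pi / 4)) k (Q a v) := by
  fin_cases k
  · exact h.comm _ _ _
  · change Q a (swapKraus (P 0) (P (Real.pi / 4)) 1 v) = swapKraus (P 0) (P (Real.pi / 4)) 1 (Q a v)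
    simp only [swapKraus_one_apply, reflOp_apply, map_sub, map_smul, h.comm]

/-- Outcomes on Ψ agree, so after flipping one side the result (0, 0) is impossible. -/
theorem zero_zero_X : P 0 (Q 0 (reflOp (P (Real.pi / 4)) Ψ)) = 0 := by
  have hM := h.mayersYao
  rw [show Q 0 (reflOp (P (Real.pi / 4)) Ψ) = reflOp (P (Real.pi / 4)) (P 0 Ψ) by
    simp only [reflOp_apply, map_sub, map_smul, h.comm, h.apply_eq zero_mem_angles₀]]
  simp only [apply_eq_reflOp (P 0), map_add, map_smul, hM.ZZ, hM.X_Z_of_mem self_mem_wordSpan, map_neg]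
  module

/-- `P 0` absorbs `Z` and the flipped vectors are annihilated, so of the four generators only the
direction of `P 0 Ψ` survives. -/
theorem zero_zero_of_mem {v : H} (hv : v ∈ pairSpan P Ψ) :
    P 0 (Q 0 v) ∈ Submodule.span ℂ {P 0 Ψ} := by
  have hp := h.isStarProjection_zero
  have hpZ : ∀ v, P 0 (Q 0 (reflOp (P 0) v)) = P 0 (Q 0 v) := fun v => by
    rw [← h.comm, ← h.comm, reflOp_apply, map_sub, map_smul, apply_apply_of_isStarProjection hp,
      two_smul, add_sub_cancel_right]
  refine wordSpan_le (N := (Submodule.span ℂ {P 0 Ψ}).comap (P 0 * Q 0).toLinearMap)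
    ?_ ?_ ?_ ?_ hv
  · change P 0 (Q 0 Ψ) ∈ Submodule.span ℂ {P 0 Ψ}
    rw [h.apply_eq zero_mem_angles₀, apply_apply_of_isStarProjection hp]
    exact Submodule.mem_span_singleton_self _
  · change P 0 (Q 0 _) ∈ Submodule.span ℂ {P 0 Ψ}
    rw [hpZ, h.apply_eq zero_mem_angles₀, apply_apply_of_isStarProjection hp]
    exact Submodule.mem_span_singleton_self _
  · change P 0 (Q 0 _) ∈ Submodule.span ℂ {P 0 Ψ}
    rw [h.zero_zero_X]
    exact zero_mem _
  · change P 0 (Q 0 _) ∈ Submodule.span ℂ {P 0 Ψ}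
    rw [hpZ, h.zero_zero_X]
    exact zero_mem _

theorem swapKraus_swapKraus (k l : Fin 2) :
    swapKraus (P 0) (P (Real.pi / 4)) k (swapKraus (Q 0) (Q (Real.pi / 4)) l Ψ) =
      if k = l then P 0 Ψ else 0 := by
  have hM := h.mayersYao
  have hp := h.isStarProjection_zero
  have hz := h.apply_eq zero_mem_angles₀
  have hx : reflOp (Q (Real.pi / 4)) Ψ = reflOp (P (Real.pi / 4)) Ψ := hM.X_eq
  have hcX : ∀ v, P 0 (reflOp (Q (Real.pi / 4)) v) = reflOp (Q (Real.pi / 4)) (P 0 v) := fun v => by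
    simp only [reflOp_apply, map_sub, map_smul, h.comm]
  -- On Ψ, `K₁` of the other side acts as `(1 - p) X`. This is annihilated by `p`, and `X(1 - p)`
  -- sends it to `p Ψ`.
  have h2 : swapKraus (Q 0) (Q (Real.pi / 4)) 1 Ψ =
      reflOp (P (Real.pi / 4)) Ψ - P 0 (reflOp (P (Real.pi / 4)) Ψ) := by
    rw [swapKraus_one_apply, hz, map_sub, ← hcX, hx]
  fin_cases k <;> fin_cases l
  · exact (congrArg _ hz).trans (apply_apply_of_isStarProjection hp Ψ)
  · change P 0 (swapKraus (Q 0) (Q (Real.pi / 4)) 1 Ψ) = 0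
    rw [h2, map_sub, apply_apply_of_isStarProjection hp, sub_self]
  · change swapKraus (P 0) (P (Real.pi / 4)) 1 (Q 0 Ψ) = 0
    rw [hz, swapKraus_one_apply, apply_apply_of_isStarProjection hp, sub_self, map_zero]
  · change swapKraus (P 0) (P (Real.pi / 4)) 1 (swapKraus (Q 0) (Q (Real.pi / 4)) 1 Ψ) = P 0 Ψ
    rw [h2, swapKraus_one_apply, map_sub (P 0), apply_apply_of_isStarProjection hp, sub_self, sub_zero]
    simp only [apply_eq_reflOp (P 0), map_add, map_sub, map_smul, hM.XX, hM.X_Z_X]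
    module

/-- Both circuits end in the ranges of `P 0` and `Q 0`, so the vector is fixed by `P 0` and `Q 0`,
and `zero_zero_of_mem` confines it to a line. -/
theorem exists_swapKraus_eq_smul {a b : ℝ} (ha : a ∈ angles) (hb : b ∈ angles) (k l : Fin 2) :
    ∃ c : ℂ, swapKraus (P 0) (P (Real.pi / 4)) k
      (P a (swapKraus (Q 0) (Q (Real.pi / 4)) l (Q b Ψ))) = c • P 0 Ψ := by
  have hQ : Q b Ψ ∈ pairSpan Q Ψ := h.symm.apply_mem hb self_mem_wordSpan
  set u := swapKraus (Q 0) (Q (Real.pi / 4)) l (Q b Ψ) with hu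
  have hu1 : u ∈ pairSpan P Ψ := by
    rw [← h.pairSpan_symm]
    exact h.symm.swapKraus_mem hQ l
  have hu2 : Q 0 u = u := h.symm.zero_swapKraus hQ l
  have hau := h.apply_mem ha hu1
  have h1 := h.zero_zero_of_mem (h.swapKraus_mem hau k)
  rw [h.swapKraus_comm, h.comm, hu2, h.zero_swapKraus hau k] at h1
  obtain ⟨c, hc⟩ := Submodule.mem_span_singleton.1 h1
  exact ⟨c, hc.symm⟩

theorem swapKraus_swapKraus_X (k : Fin 2) :
    swapKraus (P 0) (P (Real.pi / 4)) k
      (swapKraus (Q 0) (Q (Real.pi / 4)) k (reflOp (Q (Real.pi / 4)) Ψ)) = 0 := by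
  have hM := h.mayersYao
  have hx : reflOp (Q (Real.pi / 4)) Ψ = reflOp (P (Real.pi / 4)) Ψ := hM.X_eq
  have hcX : ∀ v, P 0 (reflOp (Q (Real.pi / 4)) v) = reflOp (Q (Real.pi / 4)) (P 0 v) := fun v => by
    simp only [reflOp_apply, map_sub, map_smul, h.comm]
  fin_cases k
  · change P 0 (Q 0 _) = 0
    rw [hx, h.zero_zero_X]
  · change swapKraus (P 0) (P (Real.pi / 4)) 1
      (swapKraus (Q 0) (Q (Real.pi / 4)) 1 (reflOp (Q (Real.pi / 4)) Ψ)) = 0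
    rw [swapKraus_one_apply, swapKraus_one_apply, hcX, ← map_sub, map_sub (P 0), hx, h.zero_zero_X,
      show Q 0 (reflOp (P (Real.pi / 4)) Ψ) = reflOp (P (Real.pi / 4)) (P 0 Ψ) by
        simp only [reflOp_apply, map_sub, map_smul, h.comm, h.apply_eq zero_mem_angles₀]]
    convert map_zero (reflOp (P (Real.pi / 4)))
    convert map_zero (reflOp (Q (Real.pi / 4)))
    simp only [apply_eq_reflOp (P 0), map_add, map_smul, hM.anticomm]
    module

/-- `K_k` absorbs the computational projector with outcome k. The Hadamard projector gives `(Ψ ±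
X'Ψ)/2`, whose second term is killed because equal outcomes are impossible after a one-sided flip.
-/
theorem swapKraus_hadamard (k l : Fin 2) :
    swapKraus (P 0) (P (Real.pi / 4)) k (P (angleZ k)
      (swapKraus (Q 0) (Q (Real.pi / 4)) k (Q (angleX l) Ψ))) = (2 : ℂ)⁻¹ • P 0 Ψ := by
  have hp := h.isStarProjection_zero
  have h1 : ∀ v, swapKraus (P 0) (P (Real.pi / 4)) k (P (angleZ k) v) =
      swapKraus (P 0) (P (Real.pi / 4)) k v := fun v => by
    fin_cases k
    · exact apply_apply_of_isStarProjection hp v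
    · change reflOp (P (Real.pi / 4)) (P (0 + Real.pi / 2) v - P 0 (P (0 + Real.pi / 2) v)) =
        reflOp (P (Real.pi / 4)) (v - P 0 v)
      rw [h.left.add_pi_div_two_apply zero_mem_angles₀, map_sub (P 0),
        apply_apply_of_isStarProjection hp, sub_self, sub_zero]
  have h2 : ∃ e : ℂ, Q (angleX l) Ψ = (2 : ℂ)⁻¹ • (Ψ + e • reflOp (Q (Real.pi / 4)) Ψ) := by
    fin_cases l
    · refine ⟨1, ?_⟩
      rw [one_smul]
      exact apply_eq_reflOp _ _
    · refine ⟨-1, ?_⟩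
      refine (h.right.add_pi_div_two_apply pi_div_four_mem_angles₀ Ψ).trans ?_
      rw [apply_eq_reflOp (Q (Real.pi / 4))]
      module
  obtain ⟨e, he⟩ := h2
  rw [h1, he]
  simp only [map_smul, map_add, h.swapKraus_swapKraus_X, h.swapKraus_swapKraus, if_true, smul_zero,
    add_zero]

end SimulatesPair

end Swap

/-! ### From single pairs to product operators -/

section Factors

variable {n : ℕ} {A : Fin n → Hilb.{u}} {B : Fin n → Hilb.{v}} (C : Hilb.{w})

theorem onFactor_comp (i : Fin n) (f g : A i →L[ℂ] A i) :
    onFactor i (f ∘L g) = onFactor i f ∘L onFactor i g := by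
  rw [onFactor, onFactor, onFactor, ← piMap_comp]
  congr 1
  funext j
  by_cases hj : j = i
  · subst hj; simp
  · simp [Function.update_of_ne hj]

theorem onFactor_id (i : Fin n) : onFactor i (ContinuousLinearMap.id ℂ (A i)) =
    ContinuousLinearMap.id ℂ (piTensor n A) := by
  rw [onFactor, Function.update_eq_self, piMap_id]

theorem adjoint_onFactor (i : Fin n) (f : A i →L[ℂ] A i) :
    ContinuousLinearMap.adjoint (onFactor i f) =
      onFactor i (ContinuousLinearMap.adjoint f) := by
  rw [onFactor, onFactor, adjoint_piMap]
  congr 1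
  funext j
  by_cases hj : j = i
  · subst hj; simp
  · simp only [Function.update_of_ne hj, ContinuousLinearMap.adjoint_id]

/-- A map between operator algebras that respects sums, scalars, the identity, composition and
adjoints, as a homomorphism of star algebras. -/
noncomputable def starAlgHomOfComp {E K : Type*} [NormedAddCommGroup E] [InnerProductSpace ℂ E]
    [CompleteSpace E] [NormedAddCommGroup K] [InnerProductSpace ℂ K] [CompleteSpace K]
    (φ : (E →L[ℂ] E) → (K →L[ℂ] K)) (hadd : ∀ f g, φ (f + g) = φ f + φ g)
    (hsmul : ∀ (c : ℂ) f, φ (c • f) = c • φ f)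
    (hid : φ (ContinuousLinearMap.id ℂ E) = ContinuousLinearMap.id ℂ K)
    (hcomp : ∀ f g, φ (f ∘L g) = φ f ∘L φ g)
    (hadj : ∀ f, φ (ContinuousLinearMap.adjoint f) = ContinuousLinearMap.adjoint (φ f)) :
    (E →L[ℂ] E) →⋆ₐ[ℂ] (K →L[ℂ] K) :=
  { AlgHom.ofLinearMap { toFun := φ, map_add' := hadd, map_smul' := hsmul } hid hcomp with
    map_star' := hadj }

/-- The action of the operators of the register `A i` on the whole system. -/
noncomputable def factorA (B : Fin n → Hilb.{v}) (i : Fin n) :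
    (A i →L[ℂ] A i) →⋆ₐ[ℂ] (Phys A B C →L[ℂ] Phys A B C) :=
  starAlgHomOfComp (fun f => onAB C (onFactor i f) (ContinuousLinearMap.id ℂ (piTensor n B)))
    (fun f g => by rw [onFactor, piMap_update_add, onAB_add_left, ← onFactor, ← onFactor])
    (fun c f => by rw [onFactor, piMap_update_smul, onAB_smul_left, ← onFactor])
    (by rw [onFactor_id, onAB_id])
    (fun f g => by rw [onFactor_comp, ← onAB_comp, ContinuousLinearMap.id_comp])
    (fun f => by rw [adjoint_onAB, adjoint_onFactor, ContinuousLinearMap.adjoint_id])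

/-- The action of the operators of the register `B i` on the whole system. -/
noncomputable def factorB (A : Fin n → Hilb.{u}) (i : Fin n) :
    (B i →L[ℂ] B i) →⋆ₐ[ℂ] (Phys A B C →L[ℂ] Phys A B C) :=
  starAlgHomOfComp (fun f => onAB C (ContinuousLinearMap.id ℂ (piTensor n A)) (onFactor i f))
    (fun f g => by rw [onFactor, piMap_update_add, onAB_add_right, ← onFactor, ← onFactor])
    (fun c f => by rw [onFactor, piMap_update_smul, onAB_smul_right, ← onFactor])
    (by rw [onFactor_id, onAB_id])
    (fun f g => by rw [onFactor_comp, ← onAB_comp, ContinuousLinearMap.id_comp])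
    (fun f => by rw [adjoint_onAB, adjoint_onFactor, ContinuousLinearMap.adjoint_id])

theorem onAB_onFactor (i : Fin n) (f : A i →L[ℂ] A i) (g : B i →L[ℂ] B i) :
    onAB C (onFactor i f) (onFactor i g) = factorA C B i f * factorB C A i g := by
  change _ = onAB C (onFactor i f) (ContinuousLinearMap.id ℂ _) ∘L
    onAB C (ContinuousLinearMap.id ℂ _) (onFactor i g)
  rw [← onAB_comp, ContinuousLinearMap.id_comp, ContinuousLinearMap.comp_id]

/-- Together with `onAB_onFactor` this shows that the two sides commute. -/
theorem onAB_onFactor' (i : Fin n) (f : A i →L[ℂ] A i) (g : B i →L[ℂ] B i) :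
    onAB C (onFactor i f) (onFactor i g) = factorB C A i g * factorA C B i f := by
  change _ = onAB C (ContinuousLinearMap.id ℂ _) (onFactor i g) ∘L
    onAB C (onFactor i f) (ContinuousLinearMap.id ℂ _)
  rw [← onAB_comp, ContinuousLinearMap.id_comp, ContinuousLinearMap.comp_id]

/-- The operator `⨂ i ∈ s, f i`, extended by the identity. -/
noncomputable def partialMap (s : Finset (Fin n)) (f : ∀ i, A i →L[ℂ] A i) :
    piTensor n A →L[ℂ] piTensor n A :=
  piMap n (s.piecewise f fun i => ContinuousLinearMap.id ℂ (A i))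

theorem partialMap_insert {s : Finset (Fin n)} {i : Fin n} (hi : i ∉ s)
    (f : ∀ i, A i →L[ℂ] A i) :
    partialMap (insert i s) f = onFactor i (f i) ∘L partialMap s f := by
  rw [partialMap, partialMap, onFactor, ← piMap_comp]
  congr 1
  funext j
  by_cases hj : j = i
  · subst hj; simp [hi]
  · simp [Finset.piecewise, hj]

theorem partialMap_insert' {s : Finset (Fin n)} {i : Fin n} (hi : i ∉ s)
    (f : ∀ i, A i →L[ℂ] A i) :
    partialMap (insert i s) f = partialMap s f ∘L onFactor i (f i) := by
  rw [partialMap, partialMap, onFactor, ← piMap_comp]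
  congr 1
  funext j
  by_cases hj : j = i
  · subst hj; simp [hi]
  · simp [Finset.piecewise, hj]

theorem piMap_eq_partialMap_comp (i : Fin n) (f : ∀ i, A i →L[ℂ] A i) :
    piMap n f = partialMap (Finset.univ.erase i) f ∘L onFactor i (f i) := by
  rw [← partialMap_insert' (Finset.notMem_erase i _), Finset.insert_erase (Finset.mem_univ i),
    partialMap, Finset.piecewise_univ]

theorem onFactor_comp_partialMap {s : Finset (Fin n)} {i : Fin n} (hi : i ∉ s)
    (f : ∀ i, A i →L[ℂ] A i) (g : A i →L[ℂ] A i) :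
    onFactor i g ∘L partialMap s f = partialMap s f ∘L onFactor i g := by
  rw [partialMap, onFactor, ← piMap_comp, ← piMap_comp]
  congr 1
  funext j
  by_cases hj : j = i
  · subst hj; simp [hi]
  · simp [Function.update_of_ne hj]

theorem onAB_piMap_comp {A' A'' : Fin n → Hilb.{u}} {B' B'' : Fin n → Hilb.{v}}
    (f' : ∀ i, A' i →L[ℂ] A'' i) (g' : ∀ i, B' i →L[ℂ] B'' i)
    (f : ∀ i, A i →L[ℂ] A' i) (g : ∀ i, B i →L[ℂ] B' i) :
    onAB C (piMap n fun i => f' i ∘L f i) (piMap n fun i => g' i ∘L g i) =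
      onAB C (piMap n f') (piMap n g') ∘L onAB C (piMap n f) (piMap n g) := by
  rw [piMap_comp, piMap_comp, onAB_comp]

theorem onAB_piMap_apply_apply (f' f : ∀ i, A i →L[ℂ] A i) (g' g : ∀ i, B i →L[ℂ] B i)
    (Ψ : Phys A B C) :
    onAB C (piMap n f') (piMap n g') (onAB C (piMap n f) (piMap n g) Ψ) =
      onAB C (piMap n fun i => f' i ∘L f i) (piMap n fun i => g' i ∘L g i) Ψ :=
  (DFunLike.congr_fun (onAB_piMap_comp C f' g' f g) Ψ).symm

theorem smul_onAB_piMap_apply (c : Fin n → ℂ) (f : ∀ i, A i →L[ℂ] A i) (g : ∀ i, B i →L[ℂ] B i)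
    (Ψ : Phys A B C) :
    (∏ i, c i) • onAB C (piMap n f) (piMap n g) Ψ =
      onAB C (piMap n fun i => c i • f i) (piMap n g) Ψ := by
  rw [piMap_smul, onAB_smul_left]
  rfl

/-- Product operators that agree on a vector register pair by register pair agree on it. -/
theorem onAB_piMap_apply_eq {f f' : ∀ i, A i →L[ℂ] A i} {g g' : ∀ i, B i →L[ℂ] B i}
    {Ψ : Phys A B C}
    (h : ∀ i, factorA C B i (f i) (factorB C A i (g i) Ψ) =
      factorA C B i (f' i) (factorB C A i (g' i) Ψ)) :
    onAB C (piMap n f) (piMap n g) Ψ = onAB C (piMap n f') (piMap n g') Ψ := by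
  -- The hypotheses speak of Ψ only. So the operators of the new pair act first and are exchanged
  -- there; they are then moved past those of `s`, which leave that pair alone, and the induction
  -- hypothesis applies at Ψ.
  have key : ∀ s : Finset (Fin n), onAB C (partialMap s f) (partialMap s g) Ψ =
      onAB C (partialMap s f') (partialMap s g') Ψ := fun s => by
    induction s using Finset.induction_on with
    | empty => simp only [partialMap, Finset.piecewise_empty]
    | insert i s hi ih =>
      have h1 : onAB C (onFactor i (f i)) (onFactor i (g i)) Ψ =
          onAB C (onFactor i (f' i)) (onFactor i (g' i)) Ψ := by
        rw [onAB_onFactor, onAB_onFactor]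
        exact h i
      rw [partialMap_insert' hi, partialMap_insert' hi, onAB_comp, ContinuousLinearMap.comp_apply,
        h1, ← ContinuousLinearMap.comp_apply, ← onAB_comp, ← onFactor_comp_partialMap hi,
        ← onFactor_comp_partialMap hi, onAB_comp, ContinuousLinearMap.comp_apply, ih,
        ← ContinuousLinearMap.comp_apply, ← onAB_comp, ← partialMap_insert hi,
        ← partialMap_insert hi]
  simpa only [partialMap, Finset.piecewise_univ] using key Finset.univ

theorem onAB_piMap_apply_eq_zero {f : ∀ i, A i →L[ℂ] A i} {g : ∀ i, B i →L[ℂ] B i}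
    {Ψ : Phys A B C} (i : Fin n) (h : factorA C B i (f i) (factorB C A i (g i) Ψ) = 0) :
    onAB C (piMap n f) (piMap n g) Ψ = 0 := by
  have h' : onAB C (onFactor i (f i)) (onFactor i (g i)) Ψ = 0 := by
    rw [onAB_onFactor]
    exact h
  rw [piMap_eq_partialMap_comp i f, piMap_eq_partialMap_comp i g, onAB_comp,
    ContinuousLinearMap.comp_apply, h', map_zero]

end Factors

/-! ### EPR statistics and operators on a logical qubit -/

theorem inner_ketProd_ketAngle_epr (a b : ℝ) :
    inner ℂ (ketProd (ketAngle a) (ketAngle b)) epr =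
      ((Real.cos (a - b) / √2 : ℝ) : ℂ) := by
  simp only [epr, ketProd, ket, PiLp.inner_apply, Fintype.sum_prod_type, Fin.sum_univ_two,
    PiLp.smul_apply, PiLp.add_apply, ketAngle_zero, ketAngle_one, PiLp.single_apply]
  rw [Real.cos_sub]
  simp [-Complex.ofReal_cos, -Complex.ofReal_sin]
  ring

/-- Registers act on the whole space through star homomorphisms, so the theory of one pair applies
to every i with the same global vector Ψ. -/
theorem simulatesPair_of_simulates {n : ℕ} {A : Fin n → Hilb.{u}} {B : Fin n → Hilb.{v}}
    {C : Hilb.{w}} {PA : ∀ i, ℝ → A i →L[ℂ] A i} {PB : ∀ i, ℝ → B i →L[ℂ] B i}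
    (hPA : ∀ i, IsMeasurementFamily (PA i)) (hPB : ∀ i, IsMeasurementFamily (PB i))
    {Ψ : Phys A B C} (hΨ : ‖Ψ‖ = 1)
    (hsim : ∀ i, Simulates (angles ×ˢ angles) (pairProjector C PA PB i)
      (fun p => ketProd (ketAngle p.1) (ketAngle p.2)) Ψ epr) (i : Fin n) :
    SimulatesPair (fun a => factorA C B i (PA i a)) (fun b => factorB C A i (PB i b)) Ψ where
  left a ha := ⟨(hPA i a ha).1.map _, (hPA i a ha).2.1.map _, by
    change factorA C B i (PA i a) + factorA C B i (PA i (a + Real.pi / 2)) = _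
    rw [← map_add, (hPA i a ha).2.2]
    exact map_one _⟩
  right a ha := ⟨(hPB i a ha).1.map _, (hPB i a ha).2.1.map _, by
    change factorB C A i (PB i a) + factorB C A i (PB i (a + Real.pi / 2)) = _
    rw [← map_add, (hPB i a ha).2.2]
    exact map_one _⟩
  comm a b v := DFunLike.congr_fun ((onAB_onFactor' C i (PA i a) (PB i b)).symm.trans
    (onAB_onFactor C i (PA i a) (PB i b))) v
  norm_eq_one := hΨ
  sim a ha b hb := by
    have h := hsim i (a, b) ⟨ha, hb⟩
    simp only [pairProjector, inner_ketProd_ketAngle_epr, onAB_onFactor] at h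
    refine h.trans ?_
    rw [Complex.norm_real, Real.norm_eq_abs, sq_abs, div_pow, Real.sq_sqrt zero_le_two]

theorem tensorLeft_add {X Y : Type*} [NormedAddCommGroup X] [InnerProductSpace ℂ X]
    [NormedAddCommGroup Y] [InnerProductSpace ℂ Y] (x x' : X) :
    tensorLeft (F := Y) (x + x') = tensorLeft x + tensorLeft x' := by
  simp only [tensorLeft, map_add, ContinuousLinearMap.comp_add]

theorem tensorLeft_smul {X Y : Type*} [NormedAddCommGroup X] [InnerProductSpace ℂ X]
    [NormedAddCommGroup Y] [InnerProductSpace ℂ Y] (c : ℂ) (x : X) :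
    tensorLeft (F := Y) (c • x) = c • tensorLeft x := by
  simp only [tensorLeft, map_smul, ContinuousLinearMap.comp_smul]

theorem tensorLeft_zero {X Y : Type*} [NormedAddCommGroup X] [InnerProductSpace ℂ X]
    [NormedAddCommGroup Y] [InnerProductSpace ℂ Y] : tensorLeft (F := Y) (0 : X) = 0 := by
  simp only [tensorLeft, map_zero, ContinuousLinearMap.comp_zero]

theorem qubit_eq_sum (φ : Qubit) : φ = ∑ k, φ k • ket k := by
  ext i
  fin_cases i <;> simp [ket]

theorem tensorMap_mul {X Y : Type*} [NormedAddCommGroup X] [InnerProductSpace ℂ X]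
    [NormedAddCommGroup Y] [InnerProductSpace ℂ Y] (f f' : X →L[ℂ] X) (g g' : Y →L[ℂ] Y) :
    tensorMap f g * tensorMap f' g' = tensorMap (f * f') (g * g') :=
  (tensorMap_comp _ _ _ _).symm

theorem tensorMap_one {X Y : Type*} [NormedAddCommGroup X] [InnerProductSpace ℂ X]
    [NormedAddCommGroup Y] [InnerProductSpace ℂ Y] :
    tensorMap (1 : X →L[ℂ] X) (1 : Y →L[ℂ] Y) = 1 := tensorMap_id

theorem tensorMap_zero_left {X Y : Type*} [NormedAddCommGroup X] [InnerProductSpace ℂ X]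
    [NormedAddCommGroup Y] [InnerProductSpace ℂ Y] (g : Y →L[ℂ] Y) :
    tensorMap (0 : X →L[ℂ] X) g = 0 := by
  simpa using tensorMap_smul_left 0 (0 : X →L[ℂ] X) g

theorem tensorMap_zero_right {X Y : Type*} [NormedAddCommGroup X] [InnerProductSpace ℂ X]
    [NormedAddCommGroup Y] [InnerProductSpace ℂ Y] (f : X →L[ℂ] X) :
    tensorMap f (0 : Y →L[ℂ] Y) = 0 := by
  simpa using tensorMap_smul_right 0 f (0 : Y →L[ℂ] Y)

theorem mem_unitary_of_isSelfAdjoint {X : Type*} [NormedAddCommGroup X] [InnerProductSpace ℂ X]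
    [CompleteSpace X] {f : X →L[ℂ] X} (h1 : ContinuousLinearMap.adjoint f = f) (h2 : f * f = 1) :
    f ∈ unitary (X →L[ℂ] X) := by
  rw [Unitary.mem_iff, ContinuousLinearMap.star_eq_adjoint, h1]
  exact ⟨h2, h2⟩

theorem adjoint_of_isSelfAdjoint {X : Type*} [NormedAddCommGroup X] [InnerProductSpace ℂ X]
    [CompleteSpace X] {f : X →L[ℂ] X} (h : IsSelfAdjoint f) : ContinuousLinearMap.adjoint f = f :=
  h

/-- The projector `|k⟩⟨k|` of the qubit. -/
noncomputable def qubitProj (k : Fin 2) : Qubit →L[ℂ] Qubit :=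
  Matrix.toEuclideanCLM (n := Fin 2) (𝕜 := ℂ) (Matrix.single k k 1)

/-- The bit flip of the qubit. -/
noncomputable def qubitFlip : Qubit →L[ℂ] Qubit :=
  Matrix.toEuclideanCLM (n := Fin 2) (𝕜 := ℂ) !![0, 1; 1, 0]

theorem qubitProj_apply_ket (k l : Fin 2) : qubitProj k (ket l) = if k = l then ket l else 0 := by
  ext i
  fin_cases k <;> fin_cases l <;> fin_cases i <;>
    simp [qubitProj, ket, Matrix.ofLp_toEuclideanCLM]

theorem qubitFlip_apply_ket_zero : qubitFlip (ket 0) = ket 1 := by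
  ext i
  fin_cases i <;> simp [qubitFlip, ket, Matrix.ofLp_toEuclideanCLM]

theorem qubitFlip_mul_self : qubitFlip * qubitFlip = 1 := by
  rw [qubitFlip, ← map_mul, ← map_one (Matrix.toEuclideanCLM (n := Fin 2) (𝕜 := ℂ))]
  congr 1
  ext i j
  fin_cases i <;> fin_cases j <;> simp

theorem adjoint_qubitFlip : ContinuousLinearMap.adjoint qubitFlip = qubitFlip := by
  rw [← ContinuousLinearMap.star_eq_adjoint, qubitFlip, ← map_star]
  congr 1
  ext i j
  fin_cases i <;> fin_cases j <;> simp

theorem qubitProj_mul (k l : Fin 2) :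
    qubitProj k * qubitProj l = if k = l then qubitProj k else 0 := by
  rw [qubitProj, qubitProj, ← map_mul]
  by_cases h : k = l
  · subst h
    simp
  · rw [Matrix.single_mul_single_of_ne _ _ _ _ h, map_zero, if_neg h]

theorem adjoint_qubitProj (k : Fin 2) :
    ContinuousLinearMap.adjoint (qubitProj k) = qubitProj k := by
  rw [← ContinuousLinearMap.star_eq_adjoint, qubitProj, ← map_star, Matrix.star_eq_conjTranspose,
    Matrix.conjTranspose_single, star_one]

theorem qubitProj_add : qubitProj 0 + qubitProj 1 = 1 := by
  rw [qubitProj, qubitProj, ← map_add, ← map_one (Matrix.toEuclideanCLM (n := Fin 2) (𝕜 := ℂ))]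
  congr 1
  ext i j
  fin_cases i <;> fin_cases j <;> simp

/-! ### The swap circuit as a unitary -/

section SwapUnitary

variable {E : Type*} [NormedAddCommGroup E] [InnerProductSpace ℂ E]

/-- The bit flip of the logical qubit, controlled by the projector `p` of the register. -/
noncomputable def flipIfNot (p : E →L[ℂ] E) : HTensor Qubit E →L[ℂ] HTensor Qubit E :=
  tensorMap (1 : Qubit →L[ℂ] Qubit) p + tensorMap qubitFlip (1 - p)

/-- The operator `x` of the register, controlled by the logical qubit. -/
noncomputable def controlled (x : E →L[ℂ] E) : HTensor Qubit E →L[ℂ] HTensor Qubit E :=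
  tensorMap (qubitProj 0) (1 : E →L[ℂ] E) + tensorMap (qubitProj 1) x

/-- The swap circuit of a register with projectors `p` and `r` of the computational and the
Hadamard basis. -/
noncomputable def swapUnitary (p r : E →L[ℂ] E) : HTensor Qubit E →L[ℂ] HTensor Qubit E :=
  controlled (reflOp r) * flipIfNot p

theorem flipIfNot_comp_tensorLeft (p : E →L[ℂ] E) :
    flipIfNot p ∘L tensorLeft (ket 0) = tensorLeft (ket 0) ∘L p + tensorLeft (ket 1) ∘L (1 - p) := by
  refine (ContinuousLinearMap.add_comp (tensorMap (1 : Qubit →L[ℂ] Qubit) p)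
      (tensorMap qubitFlip (1 - p)) (tensorLeft (ket 0))).trans ?_
  rw [tensorMap_comp_tensorLeft, tensorMap_comp_tensorLeft, qubitFlip_apply_ket_zero]
  rfl

theorem controlled_comp_tensorLeft_zero (x : E →L[ℂ] E) :
    controlled x ∘L tensorLeft (ket 0) = tensorLeft (ket 0) := by
  refine (ContinuousLinearMap.add_comp (tensorMap (qubitProj 0) (1 : E →L[ℂ] E))
      (tensorMap (qubitProj 1) x) (tensorLeft (ket 0))).trans ?_
  rw [tensorMap_comp_tensorLeft, tensorMap_comp_tensorLeft, qubitProj_apply_ket,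
    qubitProj_apply_ket, if_pos rfl, if_neg one_ne_zero, tensorLeft_zero]
  rw [ContinuousLinearMap.zero_comp, add_zero]
  rfl

theorem controlled_comp_tensorLeft_one (x : E →L[ℂ] E) :
    controlled x ∘L tensorLeft (ket 1) = tensorLeft (ket 1) ∘L x := by
  refine (ContinuousLinearMap.add_comp (tensorMap (qubitProj 0) (1 : E →L[ℂ] E))
      (tensorMap (qubitProj 1) x) (tensorLeft (ket 1))).trans ?_
  rw [tensorMap_comp_tensorLeft, tensorMap_comp_tensorLeft, qubitProj_apply_ket,
    qubitProj_apply_ket, if_pos rfl, if_neg zero_ne_one, tensorLeft_zero]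
  rw [ContinuousLinearMap.zero_comp, zero_add]

/-- The controlled flip records the outcome of `p` in the logical qubit; the controlled reflection
then acts in the branch |1⟩ only. -/
theorem swapUnitary_comp_tensorLeft (p r : E →L[ℂ] E) :
    swapUnitary p r ∘L tensorLeft (ket 0) = ∑ k, tensorLeft (ket k) ∘L swapKraus p r k := by
  rw [swapUnitary, ContinuousLinearMap.mul_def, ContinuousLinearMap.comp_assoc,
    flipIfNot_comp_tensorLeft, ContinuousLinearMap.comp_add, ← ContinuousLinearMap.comp_assoc,
    ← ContinuousLinearMap.comp_assoc, controlled_comp_tensorLeft_zero, controlled_comp_tensorLeft_one,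
    Fin.sum_univ_two, ContinuousLinearMap.comp_assoc]
  rfl

variable [CompleteSpace E]

theorem flipIfNot_mem_unitary {p : E →L[ℂ] E} (hp : IsStarProjection p) :
    flipIfNot p ∈ unitary (HTensor Qubit E →L[ℂ] HTensor Qubit E) := by
  refine mem_unitary_of_isSelfAdjoint ?_ ?_
  · refine (map_add ContinuousLinearMap.adjoint (tensorMap (1 : Qubit →L[ℂ] Qubit) p)
      (tensorMap qubitFlip (1 - p))).trans ?_
    rw [adjoint_tensorMap, adjoint_tensorMap, adjoint_qubitFlip,
      adjoint_of_isSelfAdjoint hp.isSelfAdjoint, adjoint_of_isSelfAdjoint hp.one_sub.isSelfAdjoint,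
      adjoint_of_isSelfAdjoint (.one _)]
    rfl
  · change (tensorMap (1 : Qubit →L[ℂ] Qubit) p + tensorMap qubitFlip (1 - p)) *
      (tensorMap (1 : Qubit →L[ℂ] Qubit) p + tensorMap qubitFlip (1 - p)) = 1
    rw [mul_add, add_mul, add_mul, tensorMap_mul, tensorMap_mul, tensorMap_mul, tensorMap_mul,
      hp.mul_one_sub_self, hp.one_sub_mul_self, hp.isIdempotentElem.eq,
      hp.one_sub.isIdempotentElem.eq, qubitFlip_mul_self, tensorMap_zero_right,
      tensorMap_zero_right, add_zero, zero_add, one_mul, ← tensorMap_add_right,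
      add_sub_cancel, tensorMap_one]

theorem controlled_mem_unitary {x : E →L[ℂ] E} (hx : IsSelfAdjoint x) (hxx : x * x = 1) :
    controlled x ∈ unitary (HTensor Qubit E →L[ℂ] HTensor Qubit E) := by
  refine mem_unitary_of_isSelfAdjoint ?_ ?_
  · refine (map_add ContinuousLinearMap.adjoint (tensorMap (qubitProj 0) (1 : E →L[ℂ] E))
      (tensorMap (qubitProj 1) x)).trans ?_
    rw [adjoint_tensorMap, adjoint_tensorMap, adjoint_qubitProj, adjoint_qubitProj,
      adjoint_of_isSelfAdjoint hx, adjoint_of_isSelfAdjoint (.one _)]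
    rfl
  · change (tensorMap (qubitProj 0) (1 : E →L[ℂ] E) + tensorMap (qubitProj 1) x) *
      (tensorMap (qubitProj 0) (1 : E →L[ℂ] E) + tensorMap (qubitProj 1) x) = 1
    rw [mul_add, add_mul, add_mul, tensorMap_mul, tensorMap_mul, tensorMap_mul, tensorMap_mul,
      qubitProj_mul, qubitProj_mul, qubitProj_mul, qubitProj_mul, if_pos rfl, if_pos rfl,
      if_neg zero_ne_one, if_neg one_ne_zero, tensorMap_zero_left, tensorMap_zero_left, add_zero,
      zero_add, hxx, one_mul, ← tensorMap_add_left, qubitProj_add, tensorMap_one]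

theorem swapUnitary_mem_unitary {p r : E →L[ℂ] E} (hp : IsStarProjection p)
    (hr : IsStarProjection r) : swapUnitary p r ∈ unitary (HTensor Qubit E →L[ℂ] HTensor Qubit E) :=
  mul_mem (controlled_mem_unitary (isSelfAdjoint_reflOp hr)
    (ContinuousLinearMap.ext fun v => reflOp_reflOp hr v)) (flipIfNot_mem_unitary hp)

end SwapUnitary

section RegisterUnitary

variable {E : Hilb.{u}}

theorem attach_eq_sum (φ : Qubit) :
    attach (E := E) φ = ∑ k, φ k • attach (E := E) (ket k) := by
  conv_lhs => rw [qubit_eq_sum φ]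
  rw [Fin.sum_univ_two, Fin.sum_univ_two]
  simp only [attach]
  rw [tensorLeft_add, tensorLeft_smul, tensorLeft_smul]
  rfl

theorem adjoint_attach_comp_attach (φ ψ : Qubit) :
    ContinuousLinearMap.adjoint (attach (E := E) φ) ∘L attach ψ =
      (inner ℂ φ ψ : ℂ) • ContinuousLinearMap.id ℂ E :=
  adjoint_tensorLeft_comp_tensorLeft φ ψ

/-- The swap circuit of a register together with its logical qubit. -/
noncomputable def registerUnitary (p r : E →L[ℂ] E) : bar E →L[ℂ] bar E := swapUnitary p r

theorem registerUnitary_mem_unitary {p r : E →L[ℂ] E} (hp : IsStarProjection p)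
    (hr : IsStarProjection r) : registerUnitary p r ∈ unitary (bar E →L[ℂ] bar E) :=
  swapUnitary_mem_unitary hp hr

theorem registerUnitary_comp_attach (p r : E →L[ℂ] E) :
    registerUnitary p r ∘L attach (ket 0) = ∑ k, attach (ket k) ∘L swapKraus p r k :=
  swapUnitary_comp_tensorLeft p r

theorem adjoint_attach_comp_registerUnitary (p r : E →L[ℂ] E) (a : ℝ) :
    ContinuousLinearMap.adjoint (attach (E := E) (ketAngle a)) ∘L
      registerUnitary p r ∘L attach (ket 0) = swapAmplitude p r a := by
  rw [registerUnitary_comp_attach, ContinuousLinearMap.comp_finsetSum, swapAmplitude]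
  refine Finset.sum_congr rfl fun k _ => ?_
  rw [← ContinuousLinearMap.comp_assoc, adjoint_attach_comp_attach, ContinuousLinearMap.smul_comp,
    ContinuousLinearMap.id_comp]
  -- The amplitudes of |a⟩ are real, so the conjugation in the inner product disappears.
  congr 1
  fin_cases k
  · simp [ket, EuclideanSpace.inner_single_right, ketAngle_zero, -Complex.ofReal_cos]
  · simp [ket, EuclideanSpace.inner_single_right, ketAngle_one, -Complex.ofReal_sin]

end RegisterUnitary

/-! ### Product states of the logical qubits -/

section Logical

variable {n : ℕ} (A : Fin n → Hilb.{u}) (B : Fin n → Hilb.{v}) (C : Hilb.{w})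

theorem ketPi_ket (x : Fin n → Fin 2) : ketPi (fun i => ket (x i)) = ket x := by
  ext y
  simp only [ketPi, ket, PiLp.single_apply, Finset.prod_ite_zero, Finset.prod_const_one]
  simp only [Finset.mem_univ, true_imp_iff, funext_iff]

theorem piMap_attach (φ : Fin n → Qubit) :
    piMap n (fun i => attach (E := A i) (φ i)) =
      ∑ x : Fin n → Fin 2, (∏ i, φ i (x i)) •
        piMap n (fun i => attach (E := A i) (ket (x i))) := by
  simp only [← piMap_smul]
  rw [← piMap_sum fun i k => φ i k • attach (E := A i) (ket k)]
  simp only [← attach_eq_sum]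

/-- Both sides are multilinear in the single-qubit states, so `logicalTensor`, defined through the
basis, attaches any product state factor by factor. -/
theorem logicalTensor_ketProd_ketPi (φ χ : Fin n → Qubit) :
    logicalTensor A B C (ketProd (ketPi φ) (ketPi χ)) =
      onAB C (piMap n fun i => attach (E := A i) (φ i))
        (piMap n fun i => attach (E := B i) (χ i)) := by
  rw [piMap_attach, piMap_attach, onAB_sum]
  refine Finset.sum_congr rfl fun x _ => Finset.sum_congr rfl fun y _ => ?_
  rw [onAB_smul_left, onAB_smul_right, smul_smul]
  rfl

theorem logicalTensor_ketProd_ket (x y : Fin n → Fin 2) :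
    logicalTensor A B C (ketProd (ket x) (ket y)) =
      onAB C (piMap n fun i => attach (E := A i) (ket (x i)))
        (piMap n fun i => attach (E := B i) (ket (y i))) := by
  rw [← ketPi_ket, ← ketPi_ket, logicalTensor_ketProd_ketPi]

end Logical

/-- The logical projector is `τ φ` times its adjoint, so the sandwiched operator is `G†G`. For
product states `G` is a product of register operators. -/
theorem adjoint_logicalProjector_apply {L H K : Type*} [NormedAddCommGroup L]
    [InnerProductSpace ℂ L] [NormedAddCommGroup H] [InnerProductSpace ℂ H] [CompleteSpace H]
    [NormedAddCommGroup K] [InnerProductSpace ℂ K] [CompleteSpace K]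
    (τ : L →ₗ[ℂ] H →L[ℂ] K) (T : H →L[ℂ] K) (U : K →L[ℂ] K) (φ : L)
    (G : H →L[ℂ] H) (hG : ContinuousLinearMap.adjoint (τ φ) ∘L U ∘L T = G) (s : H) :
    ContinuousLinearMap.adjoint T
        (ContinuousLinearMap.adjoint U (logicalProjector τ φ (U (T s)))) =
      (ContinuousLinearMap.adjoint G ∘L G) s := by
  subst hG
  simp only [logicalProjector, ContinuousLinearMap.adjoint_comp,
    ContinuousLinearMap.adjoint_adjoint, ContinuousLinearMap.comp_apply]

section SwapCircuit

variable {n : ℕ} {A : Fin n → Hilb.{u}} {B : Fin n → Hilb.{v}} (C : Hilb.{w})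
  (PA : ∀ i, ℝ → A i →L[ℂ] A i) (PB : ∀ i, ℝ → B i →L[ℂ] B i)

/-- The swap circuits of all registers of one side. -/
noncomputable def swapCircuit (PA : ∀ i, ℝ → A i →L[ℂ] A i) :
    piTensor n (fun i => bar (A i)) →L[ℂ] piTensor n (fun i => bar (A i)) :=
  piMap n fun i => registerUnitary (PA i 0) (PA i (Real.pi / 4))

/-- The operator applied to the registers when the logical qubits are found in `|x⟩ ⊗ |y⟩`. -/
noncomputable def fullKraus (x y : Fin n → Fin 2) : Phys A B C →L[ℂ] Phys A B C :=
  onAB C (piMap n fun i => swapKraus (PA i 0) (PA i (Real.pi / 4)) (x i))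
    (piMap n fun i => swapKraus (PB i 0) (PB i (Real.pi / 4)) (y i))

variable {PA PB}

theorem swapCircuit_mem_tensorUnitaries (hPA : ∀ i, IsMeasurementFamily (PA i)) :
    swapCircuit PA ∈ tensorUnitaries A :=
  ⟨_, fun i => registerUnitary_mem_unitary (hPA i 0 zero_mem_angles₀).1
    (hPA i _ pi_div_four_mem_angles₀).1, rfl⟩

theorem swapCircuit_mem_unitary (hPA : ∀ i, IsMeasurementFamily (PA i)) :
    swapCircuit PA ∈ unitary (piTensor n (fun i => bar (A i)) →L[ℂ] _) :=
  piMap_mem_unitary fun i => registerUnitary_mem_unitary (hPA i 0 zero_mem_angles₀).1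
    (hPA i _ pi_div_four_mem_angles₀).1

variable (PA PB)

theorem swapCircuit_comp_attach :
    swapCircuit PA ∘L piMap n (fun i => attach (E := A i) (ket 0)) =
      ∑ x : Fin n → Fin 2, piMap n (fun i => attach (E := A i) (ket (x i))) ∘L
        piMap n (fun i => swapKraus (PA i 0) (PA i (Real.pi / 4)) (x i)) := by
  rw [swapCircuit, ← piMap_comp]
  simp only [registerUnitary_comp_attach]
  rw [piMap_sum fun i k => attach (E := A i) (ket k) ∘L
    swapKraus (PA i 0) (PA i (Real.pi / 4)) k]
  simp only [piMap_comp]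

theorem swapCircuit_logicalTensor_zero :
    onAB C (swapCircuit PA) (swapCircuit PB) ∘L
        logicalTensor A B C (ketProd (ket 0) (ket 0)) =
      ∑ x : Fin n → Fin 2, ∑ y : Fin n → Fin 2,
        logicalTensor A B C (ketProd (ket x) (ket y)) ∘L fullKraus C PA PB x y := by
  rw [logicalTensor_ketProd_ket, ← onAB_comp]
  simp only [Pi.zero_apply]
  rw [swapCircuit_comp_attach, swapCircuit_comp_attach, onAB_sum]
  refine Finset.sum_congr rfl fun x _ => Finset.sum_congr rfl fun y _ => ?_
  rw [onAB_comp, logicalTensor_ketProd_ket, fullKraus]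

theorem adjoint_logicalTensor_comp_swapCircuit (a b : Fin n → ℝ) :
    ContinuousLinearMap.adjoint (logicalTensor A B C (ketAngles a b)) ∘L
        onAB C (swapCircuit PA) (swapCircuit PB) ∘L
        logicalTensor A B C (ketProd (ket 0) (ket 0)) =
      onAB C (piMap n fun i => swapAmplitude (PA i 0) (PA i (Real.pi / 4)) (a i))
        (piMap n fun i => swapAmplitude (PB i 0) (PB i (Real.pi / 4)) (b i)) := by
  rw [ketAngles, logicalTensor_ketProd_ketPi, logicalTensor_ketProd_ket, adjoint_onAB,
    adjoint_piMap, adjoint_piMap, swapCircuit, swapCircuit, ← onAB_piMap_comp, ← onAB_piMap_comp]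
  simp only [Pi.zero_apply, adjoint_attach_comp_registerUnitary]

theorem adjoint_onAB_piMap_comp (f : ∀ i, A i →L[ℂ] A i) (g : ∀ i, B i →L[ℂ] B i) :
    ContinuousLinearMap.adjoint (onAB C (piMap n f) (piMap n g)) ∘L
        onAB C (piMap n f) (piMap n g) =
      onAB C (piMap n fun i => star (f i) * f i) (piMap n fun i => star (g i) * g i) := by
  rw [adjoint_onAB, adjoint_piMap, adjoint_piMap, ← onAB_piMap_comp]
  rfl

theorem swapCircuit_effect (a b : Fin n → ℝ) (s : Phys A B C) :
    ContinuousLinearMap.adjoint (logicalTensor A B C (ketProd (ket 0) (ket 0)))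
      (ContinuousLinearMap.adjoint (onAB C (swapCircuit PA) (swapCircuit PB))
        (logicalProjector (logicalTensor A B C) (ketAngles a b)
          (onAB C (swapCircuit PA) (swapCircuit PB)
            (logicalTensor A B C (ketProd (ket 0) (ket 0)) s)))) =
      onAB C (piMap n fun i => swapEffect (PA i 0) (PA i (Real.pi / 4)) (a i))
        (piMap n fun i => swapEffect (PB i 0) (PB i (Real.pi / 4)) (b i)) s := by
  rw [adjoint_logicalProjector_apply _ _ _ _ _
    (adjoint_logicalTensor_comp_swapCircuit C PA PB a b), adjoint_onAB_piMap_comp]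
  rfl

end SwapCircuit

/-! ### Measured vectors of all n pairs under the swap circuit -/

section Hybrid

variable {n : ℕ} {A : Fin n → Hilb.{u}} {B : Fin n → Hilb.{v}} {C : Hilb.{w}}
  {PA : ∀ i, ℝ → A i →L[ℂ] A i} {PB : ∀ i, ℝ → B i →L[ℂ] B i} {Ψ : Phys A B C}
  (h : ∀ i, SimulatesPair (fun a => factorA C B i (PA i a)) (fun b => factorB C A i (PB i b)) Ψ)

/-- The component `(P_A^{0⋯0} ⊗ Id) Ψ`. -/
noncomputable def zeroPart (PA : ∀ i, ℝ → A i →L[ℂ] A i) (Ψ : Phys A B C) : Phys A B C :=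
  onAB C (piMap n fun i => PA i 0) (piMap n fun i => ContinuousLinearMap.id ℂ (B i)) Ψ

include h

/-- In each pair the B effect acts on a vector of the B span and can be replaced by its projector.
The result lies in the common span, is kept there by the A projector of `q`, and the A effect is
replaced in turn. -/
theorem fullProjector_fullProjector {p q : (Fin n → ℝ) × (Fin n → ℝ)} (hp : p ∈ anglePairs n)
    (hq : q ∈ anglePairs n) :
    fullProjector C PA PB p (fullProjector C PA PB q Ψ) =
      onAB C (piMap n fun i => swapEffect (PA i 0) (PA i (Real.pi / 4)) (p.1 i))
        (piMap n fun i => swapEffect (PB i 0) (PB i (Real.pi / 4)) (p.2 i))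
        (fullProjector C PA PB q Ψ) := by
  refine (onAB_piMap_apply_apply C _ _ _ _ _).trans ((onAB_piMap_apply_eq C fun i => ?_).trans
    (onAB_piMap_apply_apply C _ _ _ _ _).symm)
  simp only [← ContinuousLinearMap.mul_def, map_mul, mul_apply_eq_comp, map_swapEffect]
  have h1 : factorB C A i (PB i (q.2 i)) Ψ ∈ pairSpan (fun b => factorB C A i (PB i b)) Ψ :=
    (h i).symm.apply_mem (hq.2 i) self_mem_wordSpan
  have h2 := (h i).symm.swapEffect_of_mem (hp.2 i) h1
  have h3 := (h i).symm.apply_mem (hp.2 i) h1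
  rw [(h i).pairSpan_symm] at h3
  have h4 := (h i).swapEffect_of_mem (hp.1 i) ((h i).apply_mem (hq.1 i) h3)
  rw [h2]
  exact h4.symm

theorem fullProjector_of_mem {p : (Fin n → ℝ) × (Fin n → ℝ)} (hp : p ∈ anglePairs n)
    {s : Phys A B C} (hs : s ∈ measuredSpan C PA PB Ψ) :
    fullProjector C PA PB p s =
      onAB C (piMap n fun i => swapEffect (PA i 0) (PA i (Real.pi / 4)) (p.1 i))
        (piMap n fun i => swapEffect (PB i 0) (PB i (Real.pi / 4)) (p.2 i)) s := by
  induction hs using Submodule.span_induction with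
  | mem x hx =>
    obtain ⟨q, hq, rfl⟩ := hx
    exact fullProjector_fullProjector h hp hq
  | zero => rw [map_zero, map_zero]
  | add x y _ _ hx hy => rw [map_add, map_add, hx, hy]
  | smul c x _ hx => rw [map_smul, map_smul, hx]

theorem fullKraus_apply (x y : Fin n → Fin 2) :
    fullKraus C PA PB x y Ψ = if x = y then zeroPart PA Ψ else 0 := by
  have key : ∀ i, factorA C B i (swapKraus (PA i 0) (PA i (Real.pi / 4)) (x i))
      (factorB C A i (swapKraus (PB i 0) (PB i (Real.pi / 4)) (y i)) Ψ) =
      if x i = y i then factorA C B i (PA i 0) Ψ else 0 := fun i => by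
    rw [map_swapKraus, map_swapKraus]
    exact (h i).swapKraus_swapKraus (x i) (y i)
  split_ifs with hxy
  · refine onAB_piMap_apply_eq C fun i => ?_
    rw [key, if_pos (congrFun hxy i)]
    exact congrArg _ (DFunLike.congr_fun (map_one (factorB C A i)) Ψ).symm
  · obtain ⟨i, hi⟩ := Function.ne_iff.1 hxy
    exact onAB_piMap_apply_eq_zero C i ((key i).trans (if_neg hi))

theorem exists_fullKraus_fullProjector {p : (Fin n → ℝ) × (Fin n → ℝ)} (hp : p ∈ anglePairs n)
    (x y : Fin n → Fin 2) :
    ∃ c : ℂ, fullKraus C PA PB x y (fullProjector C PA PB p Ψ) = c • zeroPart PA Ψ := by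
  choose c hc using fun i => (h i).exists_swapKraus_eq_smul (hp.1 i) (hp.2 i) (x i) (y i)
  refine ⟨∏ i, c i, ?_⟩
  refine (onAB_piMap_apply_apply C _ _ _ _ _).trans ((onAB_piMap_apply_eq C fun i => ?_).trans
    (smul_onAB_piMap_apply C _ _ _ _).symm)
  simp only [← ContinuousLinearMap.mul_def, map_mul, mul_apply_eq_comp, map_swapKraus, map_smul]
  refine (hc i).trans ?_
  rw [smul_apply]
  exact congrArg _ (congrArg _ (DFunLike.congr_fun (map_one (factorB C A i)) Ψ).symm)

theorem fullKraus_fullProjector_hadamard (x y : Fin n → Fin 2) :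
    fullKraus C PA PB x x (fullProjector C PA PB (fun i => angleZ (x i), fun i => angleX (y i)) Ψ) =
      (∏ _i : Fin n, (2 : ℂ)⁻¹) • zeroPart PA Ψ := by
  refine (onAB_piMap_apply_apply C _ _ _ _ _).trans ((onAB_piMap_apply_eq C fun i => ?_).trans
    (smul_onAB_piMap_apply C _ _ _ _).symm)
  simp only [← ContinuousLinearMap.mul_def, map_mul, mul_apply_eq_comp, map_swapKraus, map_smul]
  refine ((h i).swapKraus_hadamard (x i) (y i)).trans ?_
  rw [smul_apply]
  exact congrArg _ (congrArg _ (DFunLike.congr_fun (map_one (factorB C A i)) Ψ).symm)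

end Hybrid

/-! ### Membership of Ψ in S and orthogonal vectors in S -/

section Span

theorem IsMeasurementFamily.sum_angleZ {E : Type*} [NormedAddCommGroup E] [InnerProductSpace ℂ E]
    [CompleteSpace E] {P : ℝ → E →L[ℂ] E} (hP : IsMeasurementFamily P) :
    ∑ k, P (angleZ k) = ContinuousLinearMap.id ℂ E :=
  (Fin.sum_univ_two _).trans (hP 0 zero_mem_angles₀).2.2

theorem IsMeasurementFamily.mul_eq_zero {E : Type*} [NormedAddCommGroup E] [InnerProductSpace ℂ E]
    [CompleteSpace E] {P : ℝ → E →L[ℂ] E} (hP : IsMeasurementFamily P) {a : ℝ}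
    (ha : a ∈ angles₀) {k l : Fin 2} (hkl : k ≠ l) :
    P (![a, a + Real.pi / 2] k) * P (![a, a + Real.pi / 2] l) = 0 := by
  have h1 : P (a + Real.pi / 2) = 1 - P a := eq_sub_of_add_eq' (hP a ha).2.2
  fin_cases k <;> fin_cases l
  · exact absurd rfl hkl
  · change P a * P (a + Real.pi / 2) = 0
    rw [h1, (hP a ha).1.mul_one_sub_self]
  · change P (a + Real.pi / 2) * P a = 0
    rw [h1, (hP a ha).1.one_sub_mul_self]
  · exact absurd rfl hkl

variable {n : ℕ} {A : Fin n → Hilb.{u}} {B : Fin n → Hilb.{v}} {C : Hilb.{w}}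
  {PA : ∀ i, ℝ → A i →L[ℂ] A i} {PB : ∀ i, ℝ → B i →L[ℂ] B i}
  (hPA : ∀ i, IsMeasurementFamily (PA i)) (hPB : ∀ i, IsMeasurementFamily (PB i))

include hPA hPB

/-- The projectors of the computational bases of all registers sum to the identity. -/
theorem self_mem_measuredSpan (Ψ : Phys A B C) : Ψ ∈ measuredSpan C PA PB Ψ := by
  have h1 : ∑ x : Fin n → Fin 2, ∑ y : Fin n → Fin 2,
      fullProjector C PA PB (fun i => angleZ (x i), fun i => angleZ (y i)) =
        ContinuousLinearMap.id ℂ (Phys A B C) := by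
    simp only [fullProjector]
    rw [← onAB_sum, ← piMap_sum fun i k => PA i (angleZ k), ← piMap_sum fun i k => PB i (angleZ k)]
    simp only [(hPA _).sum_angleZ, (hPB _).sum_angleZ]
    rw [piMap_id, piMap_id, onAB_id]
  have h2 : (∑ x : Fin n → Fin 2, ∑ y : Fin n → Fin 2,
      fullProjector C PA PB (fun i => angleZ (x i), fun i => angleZ (y i))) Ψ ∈
        measuredSpan C PA PB Ψ := by
    simp only [sum_apply]
    exact sum_mem fun x _ => sum_mem fun y _ => Submodule.subset_span
      ⟨_, ⟨fun i => angleZ_mem _, fun i => angleZ_mem _⟩, rfl⟩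
  rwa [h1] at h2

theorem adjoint_fullProjector_comp {p q : (Fin n → ℝ) × (Fin n → ℝ)} (hp : p ∈ anglePairs n) :
    ContinuousLinearMap.adjoint (fullProjector C PA PB p) ∘L fullProjector C PA PB q =
      onAB C (piMap n fun i => PA i (p.1 i) * PA i (q.1 i))
        (piMap n fun i => PB i (p.2 i) * PB i (q.2 i)) := by
  have h1 : ∀ i, ContinuousLinearMap.adjoint (PA i (p.1 i)) = PA i (p.1 i) := fun i =>
    adjoint_of_isSelfAdjoint ((hPA i).isStarProjection (hp.1 i)).isSelfAdjoint
  have h2 : ∀ i, ContinuousLinearMap.adjoint (PB i (p.2 i)) = PB i (p.2 i) := fun i =>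
    adjoint_of_isSelfAdjoint ((hPB i).isStarProjection (hp.2 i)).isSelfAdjoint
  rw [fullProjector, fullProjector, adjoint_onAB, adjoint_piMap, adjoint_piMap,
    ← onAB_piMap_comp]
  simp only [h1, h2, ContinuousLinearMap.mul_def]

/-- Distinct labels differ in some register, where the two projectors are complementary outcomes of
one measurement and multiply to 0. -/
theorem inner_fullProjector_eq_zero (Ψ : Phys A B C)
    {x y : (Fin n → Fin 2) × (Fin n → Fin 2)} (hxy : x ≠ y) :
    inner ℂ (fullProjector C PA PB (fun i => angleZ (x.1 i), fun i => angleX (x.2 i)) Ψ)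
      (fullProjector C PA PB (fun i => angleZ (y.1 i), fun i => angleX (y.2 i)) Ψ) = 0 := by
  have h0 : ContinuousLinearMap.adjoint
      (fullProjector C PA PB (fun i => angleZ (x.1 i), fun i => angleX (x.2 i))) ∘L
      fullProjector C PA PB (fun i => angleZ (y.1 i), fun i => angleX (y.2 i)) = 0 := by
    rw [adjoint_fullProjector_comp hPA hPB ⟨fun i => angleZ_mem _, fun i => angleX_mem _⟩]
    by_cases h1 : x.1 = y.1
    · obtain ⟨i, hi⟩ := Function.ne_iff.1 fun h2 => hxy (Prod.ext h1 h2)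
      rw [piMap_eq_zero (A := B) i ((hPB i).mul_eq_zero pi_div_four_mem_angles₀ hi),
        onAB_zero_right]
    · obtain ⟨i, hi⟩ := Function.ne_iff.1 h1
      rw [piMap_eq_zero (A := A) i ((hPA i).mul_eq_zero zero_mem_angles₀ hi), onAB_zero_left]
  rw [← ContinuousLinearMap.adjoint_inner_right, ← ContinuousLinearMap.comp_apply, h0]
  exact inner_zero_right _

end Span

theorem finrank_eq_card_of_orthogonal_of_map_le {H K F ι : Type*} [NormedAddCommGroup H]
    [InnerProductSpace ℂ H] [AddCommGroup K] [Module ℂ K] [AddCommGroup F] [Module ℂ F]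
    [FiniteDimensional ℂ F] [Fintype ι] {S : Submodule ℂ H} {J : H →ₗ[ℂ] K}
    (hJ : Function.Injective J) {T : F →ₗ[ℂ] K} (hT : S.map J ≤ LinearMap.range T)
    (hF : Module.finrank ℂ F = Fintype.card ι) {v : ι → H} (hv : ∀ i, v i ∈ S)
    (hne : ∀ i, v i ≠ 0) (horth : Pairwise fun i j => inner ℂ (v i) (v j) = 0) :
    Module.finrank ℂ S = Fintype.card ι := by
  let e : S ≃ₗ[ℂ] S.map J := Submodule.equivMapOfInjective J hJ S
  have : FiniteDimensional ℂ (S.map J) := Submodule.finiteDimensional_of_le hT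
  -- In infinite dimension `finrank` is 0 by default, and independent vectors would give no lower
  -- bound.
  have : FiniteDimensional ℂ S := e.symm.finiteDimensional
  refine le_antisymm ?_ ?_
  · rw [e.finrank_eq, ← hF]
    exact (Submodule.finrank_mono hT).trans (LinearMap.finrank_range_le T)
  · have h1 : LinearIndependent ℂ v := linearIndependent_of_ne_zero_of_inner_eq_zero hne horth
    have h2 : LinearIndependent ℂ fun i => (⟨v i, hv i⟩ : S) :=
      LinearIndependent.of_comp S.subtype h1
    exact h2.fintype_card_le_finrank

/-- Used to move the normalization 2^{-n/2} of `eprN` into the residual state. -/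
theorem apply_smul_sum_apply_smul {L H K X : Type*} [AddCommGroup L] [Module ℂ L]
    [NormedAddCommGroup H] [InnerProductSpace ℂ H] [NormedAddCommGroup K] [InnerProductSpace ℂ K]
    [Fintype X] (τ : L →ₗ[ℂ] H →L[ℂ] K) {c : ℂ} (hc : c ≠ 0) (k : X → L) (s : H) :
    τ ((1 / c) • ∑ x, k x) (c • s) = ∑ x, τ (k x) s := by
  rw [map_smul τ, smul_apply, map_smul, smul_smul, one_div, inv_mul_cancel₀ hc, one_smul, map_sum,
    sum_apply]

/-! ### State equivalence and the dimension of S -/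

section Main

variable {n : ℕ} {A : Fin n → Hilb.{u}} {B : Fin n → Hilb.{v}} {C : Hilb.{w}}

theorem adjoint_logicalTensor_zero_comp :
    ContinuousLinearMap.adjoint (logicalTensor A B C (ketProd (ket 0) (ket 0))) ∘L
      logicalTensor A B C (ketProd (ket 0) (ket 0)) = ContinuousLinearMap.id ℂ (Phys A B C) := by
  have h : inner ℂ (ket 0 : Qubit) (ket 0) = (1 : ℂ) := by
    simp [ket]
  rw [logicalTensor_ketProd_ket, adjoint_onAB, adjoint_piMap, adjoint_piMap,
    ← onAB_piMap_comp]
  simp only [Pi.zero_apply, adjoint_attach_comp_attach, h, one_smul]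
  rw [piMap_id, piMap_id, onAB_id]

theorem injective_of_adjoint_comp {H K : Type*} [NormedAddCommGroup H] [InnerProductSpace ℂ H]
    [CompleteSpace H] [NormedAddCommGroup K] [InnerProductSpace ℂ K] [CompleteSpace K]
    {T : H →L[ℂ] K} (hT : ContinuousLinearMap.adjoint T ∘L T = ContinuousLinearMap.id ℂ H)
    {U : K →L[ℂ] K} (hU : U ∈ unitary (K →L[ℂ] K)) : Function.Injective (U ∘L T) := by
  have h1 : Function.LeftInverse (ContinuousLinearMap.adjoint T) T := DFunLike.congr_fun hT
  have h2 : Function.LeftInverse (ContinuousLinearMap.adjoint U) U :=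
    DFunLike.congr_fun (Unitary.mem_iff.1 hU).1
  exact h2.injective.comp h1.injective

variable {PA : ∀ i, ℝ → A i →L[ℂ] A i} {PB : ∀ i, ℝ → B i →L[ℂ] B i} {Ψ : Phys A B C}

theorem swapCircuit_logicalTensor_zero_apply (s : Phys A B C) :
    onAB C (swapCircuit PA) (swapCircuit PB)
        (logicalTensor A B C (ketProd (ket 0) (ket 0)) s) =
      ∑ x : Fin n → Fin 2, ∑ y : Fin n → Fin 2,
        logicalTensor A B C (ketProd (ket x) (ket y)) (fullKraus C PA PB x y s) := by
  refine (DFunLike.congr_fun (swapCircuit_logicalTensor_zero C PA PB) s).trans ?_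
  simp only [sum_apply, ContinuousLinearMap.comp_apply]

variable
  (h : ∀ i, SimulatesPair (fun a => factorA C B i (PA i a)) (fun b => factorB C A i (PB i b)) Ψ)

include h

theorem swapCircuit_apply_self :
    onAB C (swapCircuit PA) (swapCircuit PB)
        (logicalTensor A B C (ketProd (ket 0) (ket 0)) Ψ) =
      logicalTensor A B C (eprN n) ((Real.sqrt (2 ^ n) : ℂ) • zeroPart PA Ψ) := by
  have hs : (Real.sqrt (2 ^ n) : ℂ) ≠ 0 := by
    rw [Complex.ofReal_ne_zero]
    positivity
  rw [swapCircuit_logicalTensor_zero_apply]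
  refine Eq.trans (Finset.sum_congr rfl fun x _ => ?_) (apply_smul_sum_apply_smul _ hs _ _).symm
  refine (Finset.sum_eq_single x (fun y _ hy => ?_) fun hx => absurd (Finset.mem_univ x) hx).trans ?_
  · rw [fullKraus_apply h, if_neg hy.symm]
    exact map_zero _
  · rw [fullKraus_apply h, if_pos rfl]

theorem exists_swapCircuit_apply {p : (Fin n → ℝ) × (Fin n → ℝ)} (hp : p ∈ anglePairs n) :
    ∃ φ : Logical n, logicalTensor A B C φ (zeroPart PA Ψ) =
      onAB C (swapCircuit PA) (swapCircuit PB)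
        (logicalTensor A B C (ketProd (ket 0) (ket 0)) (fullProjector C PA PB p Ψ)) := by
  choose c hc using exists_fullKraus_fullProjector h hp
  refine ⟨∑ x, ∑ y, c x y • ketProd (ket x) (ket y), ?_⟩
  rw [swapCircuit_logicalTensor_zero_apply]
  simp only [hc, map_sum, sum_apply, map_smul, smul_apply]

variable (hPA : ∀ i, IsMeasurementFamily (PA i)) (hPB : ∀ i, IsMeasurementFamily (PB i))

include hPA hPB

theorem finrank_measuredSpan (hΨ : ‖Ψ‖ = 1) : Module.finrank ℂ (measuredSpan C PA PB Ψ) = 4 ^ n := by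
  have hU : onAB C (swapCircuit PA) (swapCircuit PB) ∈ unitary _ :=
    onAB_mem_unitary C (swapCircuit_mem_unitary hPA) (swapCircuit_mem_unitary hPB)
  have hinj := injective_of_adjoint_comp (adjoint_logicalTensor_zero_comp (A := A) (B := B)
    (C := C)) hU
  -- Otherwise the injective map `U 𝕀` would send the unit vector Ψ to 0.
  have hκ : zeroPart PA Ψ ≠ 0 := fun h0 => by
    have h1 := swapCircuit_apply_self h
    rw [h0, smul_zero, map_zero] at h1
    have h2 : Ψ = 0 := hinj (h1.trans (map_zero _).symm)
    rw [h2, norm_zero] at hΨ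
    exact zero_ne_one hΨ
  have hcard : Fintype.card ((Fin n → Fin 2) × (Fin n → Fin 2)) = 4 ^ n := by
    rw [Fintype.card_prod, Fintype.card_pi, Finset.prod_const, Finset.card_univ, Fintype.card_fin,
      Fintype.card_fin, ← mul_pow]
    norm_num
  rw [← hcard]
  refine finrank_eq_card_of_orthogonal_of_map_le (F := Logical n)
    (J := (onAB C (swapCircuit PA) (swapCircuit PB) ∘L
      logicalTensor A B C (ketProd (ket 0) (ket 0))).toLinearMap) hinj
    -- The map `φ ↦ φ ⊗ zeroPart`, whose range contains `U 𝕀 S`.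
    (T := (ContinuousLinearMap.apply ℂ _ (zeroPart PA Ψ)).toLinearMap ∘ₗ logicalTensor A B C)
    ?_ finrank_euclideanSpace
    (v := fun x => fullProjector C PA PB (fun i => angleZ (x.1 i), fun i => angleX (x.2 i)) Ψ)
    (fun x => Submodule.subset_span ⟨_, ⟨fun i => angleZ_mem _, fun i => angleX_mem _⟩, rfl⟩)
    (fun x hx => ?_) (fun x y hxy => inner_fullProjector_eq_zero hPA hPB Ψ hxy)
  · rw [measuredSpan, Submodule.map_span_le]
    rintro _ ⟨p, hp, rfl⟩
    exact exists_swapCircuit_apply h hp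
  · have h1 := fullKraus_fullProjector_hadamard h x.1 x.2
    rw [hx, map_zero] at h1
    exact hκ ((smul_eq_zero.1 h1.symm).resolve_left
      (Finset.prod_ne_zero_iff.2 fun _ _ => inv_ne_zero two_ne_zero))

theorem stateEquivalent_swapCircuit :
    StateEquivalent (logicalTensor A B C) (ketProd (ket 0) (ket 0)) (anglePairs n)
      (fullProjector C PA PB) (fun p => ketAngles p.1 p.2)
      (onAB C (swapCircuit PA) (swapCircuit PB)) (measuredSpan C PA PB Ψ) Ψ (eprN n) := by
  have hU : onAB C (swapCircuit PA) (swapCircuit PB) ∈ unitary _ :=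
    onAB_mem_unitary C (swapCircuit_mem_unitary hPA) (swapCircuit_mem_unitary hPB)
  refine ⟨self_mem_measuredSpan hPA hPB Ψ, ⟨hU, fun p hp s hs => ?_⟩,
    (Real.sqrt (2 ^ n) : ℂ) • zeroPart PA Ψ, ?_⟩
  · exact (fullProjector_of_mem h hp hs).trans (swapCircuit_effect C PA PB p.1 p.2 s).symm
  · rw [← swapCircuit_apply_self h]
    exact (DFunLike.congr_fun (Unitary.mem_iff.1 hU).1 _).symm

end Main

end SelfTest

theorem mainTheorem10 {n : ℕ} (A : Fin n → SelfTest.Hilb.{u}) (B : Fin n → SelfTest.Hilb.{v})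
    (C : SelfTest.Hilb.{w})
    (PA : ∀ i, ℝ → A i →L[ℂ] A i) (PB : ∀ i, ℝ → B i →L[ℂ] B i)
    (hPA : ∀ i, SelfTest.IsMeasurementFamily (PA i))
    (hPB : ∀ i, SelfTest.IsMeasurementFamily (PB i))
    (Ψ : SelfTest.Phys A B C) (hΨ : ‖Ψ‖ = 1)
    (hsim : ∀ i, SelfTest.Simulates (SelfTest.angles ×ˢ SelfTest.angles)
      (SelfTest.pairProjector C PA PB i)
      (fun p => SelfTest.ketProd (SelfTest.ketAngle p.1) (SelfTest.ketAngle p.2))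
      Ψ SelfTest.epr) :
    (∃ UA ∈ SelfTest.tensorUnitaries A, ∃ UB ∈ SelfTest.tensorUnitaries B,
      SelfTest.StateEquivalent (SelfTest.logicalTensor A B C)
        (SelfTest.ketProd (SelfTest.ket 0) (SelfTest.ket 0)) (SelfTest.anglePairs n)
        (SelfTest.fullProjector C PA PB) (fun p => SelfTest.ketAngles p.1 p.2)
        (SelfTest.onAB C UA UB) (SelfTest.measuredSpan C PA PB Ψ) Ψ (SelfTest.eprN n)) ∧
    Module.finrank ℂ (SelfTest.measuredSpan C PA PB Ψ) = 4 ^ n := by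
  have h := SelfTest.simulatesPair_of_simulates hPA hPB hΨ hsim
  exact ⟨⟨_, SelfTest.swapCircuit_mem_tensorUnitaries hPA, _,
    SelfTest.swapCircuit_mem_tensorUnitaries hPB,
    SelfTest.stateEquivalent_swapCircuit h hPA hPB⟩, SelfTest.finrank_measuredSpan h hPA hPB hΨ⟩
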